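/- Write $\langle f,g\rangle=\int_{\mathbb R}fg$, $\|f\|=\langle f,f\rangle^{1/2}$, let all functions be real valued, and let $\xi_1,\xi_2$ be the Hermite cubic splines supported in $[-1,1]$: $\xi_1(x)=(x+1)^2(1-2x)$ and $\xi_2(x)=(x+1)^2x$ on $[-1,0]$, $\xi_1(x)=(1-x)^2(1+2x)$ and $\xi_2(x)=(1-x)^2x$ on $[0,1]$, and $\xi_1=\xi_2=0$ elsewhere. Put $\xi_{j,2k+l-1}(x)=2^{j/2}\xi_l(2^jx-k)$ for $l=1,2$ and $j,k\in\mathbb Z$, and $\tilde V_j=\overline{\mathrm{span}}\{\xi_{j,k}:k\in\mathbb Z\}\subset L^2(\mathbb R)$. Let $\mathcal A_0=\mathrm{span}\{\xi_{1,2},\xi_{1,3}\}$, $\mathcal A_1=\mathrm{span}\{\xi_{2,k}:2\le k\le 7\}$, $\mathcal B_0=\mathrm{span}(\{\xi_{1,0}\chi_{[0,1]},\xi_{1,1}\chi_{[0,1]}\}\cup\mathcal A_0)$, $\mathcal B_1=\mathrm{span}(\{\xi_{1,4}\chi_{[0,1]},\xi_{1,5}\chi_{[0,1]}\}\cup\mathcal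 A_0)$, and $\mathcal C_h=\mathcal B_h\ominus\mathcal A_0$ for $h=0,1$, where $\ominus$ denotes the orthogonal complement. Call $(\phi_3,\phi_4)$ admissible if it is an orthonormal basis of a subspace $W\subset\mathcal A_1\ominus\mathcal A_0$ such that $(I-P_W)\mathcal C_0\perp(I-P_W)\mathcal C_1$, where $P_W$ is the orthogonal projection onto $W$. Given an admissible pair, put $\phi_1=\xi_{1,2}/\|\xi_{1,2}\|$, $\phi_2=\xi_{1,3}/\|\xi_{1,3}\|$, and $$g_5=\xi_{1,0}-\sum_{j=1}^4\langle\xi_{1,0},\phi_j\rangle\phi_j-\sum_{j=1}^4\langle\xi_{1,0},\phi_j(\cdot+1)\rangle\phi_j(\cdot+1),\qquad \phi_5=g_5/\|g_5\|,$$ $$g_6=\xi_{1,1}-\sum_{j=1}^5\langle\xi_{1,1},\phi_j\rangle\phi_j-\sum_{j=1}^5\langle\xi_{1,1},\phi_j(\cdot+1)\rangle\phi_j(\cdot+1),\qquad \phi_6=g_6/\|g_6\|.$$ For $j,k\in\mathbb Z$ let $\phi_{j,6k+l}(x)=2^{j/2}\phi_l(2^jx-k)$ for $l=1,2,3,4$,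 let $\phi_{j,6k+l}(x)=2^{j/2}\phi_l(2^jx-k-1)$ for $l=5,6$, and let $V_j=\overline{\mathrm{span}}\{\phi_{j,k}:k\in\mathbb Z\}\subset L^2(\mathbb R)$. **Theorem.** Admissible pairs $(\phi_3,\phi_4)$ exist, and for every admissible pair the following hold. a) The generators $\phi_i$, $i=1,\dots,6$, and the scaling functions $\phi_{j,k}$, $j,k\in\mathbb Z$, are cubic splines (piecewise polynomials of degree at most $3$ with finitely many knots) belonging to $C^1(\mathbb R)$. b) $\{V_j\}_{j\in\mathbb Z}$ is an orthogonal multiresolution analysis of $L^2(\mathbb R)$ generated by $\phi_1,\dots,\phi_6$. That is, the $V_j$ are closed subspaces with $V_j\subset V_{j+1}$ for all $j$; $f\in V_j$ if and only if $f(2^{-j}\cdot)\in V_0$; $\bigcup_jV_j$ is dense in $L^2(\mathbb R)$; $\bigcap_jV_j=\{0\}$; and the functions $\phi_i(\cdot-k)$, $i=1,\dots,6$, $k\in\mathbb Z$, are a Riesz basis of $V_0$, and indeed an orthonormal basis of $V_0$. Moreover, there are integers $q\ge0$ and $n\ge1$ such that $\tilde V_q\subset V_0\subset\tilde V_{q+n}$.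 -/

import Mathlib

open MeasureTheory

noncomputable section

namespace SplineMRA

/-- The real Hilbert space `L²(ℝ)`. -/
abbrev L2R : Type := Lp ℝ 2 (volume : Measure ℝ)

/-- The `L²` inner product of two functions on the real line. -/
def ip (f g : ℝ → ℝ) : ℝ := ∫ x, f x * g x

/-- The `L²` norm of a function on the real line. -/
def l2norm (f : ℝ → ℝ) : ℝ := Real.sqrt (ip f f)

/-- The closed subspace of `L²(ℝ)` spanned by (the classes of) a family of functions. -/
def closedSpan {ι : Type*} (F : ι → ℝ → ℝ) : Submodule ℝ L2R :=
  (Submodule.span ℝ {g : L2R | ∃ i, ⇑g =ᵐ[volume] F i}).topologicalClosure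

/-! ### Splines -/

/-- `f` is a cubic spline: a piecewise polynomial of degree at most three with finitely many knots;
it is a cubic polynomial on every interval that contains no knot. -/
def IsCubicSpline (f : ℝ → ℝ) : Prop :=
  ∃ t : Finset ℝ, ∀ I : Set ℝ, I.OrdConnected → Disjoint I (t : Set ℝ) →
    ∃ p : Polynomial ℝ, p.natDegree ≤ 3 ∧ ∀ x ∈ I, f x = p.eval x

/-! ### Multiresolution analyses -/

/-- `e` is a Riesz basis of the closed subspace `V`. -/
def IsRieszBasis {ι : Type*} (e : ι → L2R) (V : Submodule ℝ L2R) : Prop :=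
  (Submodule.span ℝ (Set.range e)).topologicalClosure = V ∧
  ∃ c C : ℝ, 0 < c ∧ 0 < C ∧ ∀ b : lp (fun _ : ι => ℝ) 2,
    Summable (fun i => b i • e i) ∧
    c * ‖b‖ ≤ ‖∑' i, b i • e i‖ ∧ ‖∑' i, b i • e i‖ ≤ C * ‖b‖

/-- `e (i, k)` is the class in `L²(ℝ)` of the integer translate `φ i (· - k)`. -/
def IsTranslateFamily {p : ℕ} (φ : Fin p → ℝ → ℝ) (e : Fin p × ℤ → L2R) : Prop :=
  ∀ (i : Fin p) (k : ℤ), ⇑(e (i, k)) =ᵐ[volume] fun x => φ i (x - k)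

/-- `V` is a multiresolution analysis of `L²(ℝ)` of multiplicity `p` generated by the functions
`φ i`. -/
structure IsMRA (V : ℤ → Submodule ℝ L2R) {p : ℕ} (φ : Fin p → ℝ → ℝ) : Prop where
  closed : ∀ j, IsClosed (V j : Set L2R)
  nested : ∀ j, V j ≤ V (j + 1)
  dilation : ∀ (j : ℤ) (f : L2R),
    f ∈ V j ↔ ∃ g ∈ V 0, ⇑g =ᵐ[volume] fun x => f ((2 : ℝ) ^ (-j) * x)
  dense : Dense (⋃ j, (V j : Set L2R))
  inter : ⨅ j, V j = ⊥
  riesz : ∃ e : Fin p × ℤ → L2R, IsTranslateFamily φ e ∧ IsRieszBasis e (V 0)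

/-- An orthogonal multiresolution analysis: the integer translates of the generators are an
orthonormal basis of `V 0`. -/
structure IsOrthogonalMRA (V : ℤ → Submodule ℝ L2R) {p : ℕ} (φ : Fin p → ℝ → ℝ) : Prop
    extends IsMRA V φ where
  orthonormal_basis : ∃ e : Fin p × ℤ → L2R, IsTranslateFamily φ e ∧ Orthonormal ℝ e ∧
    (Submodule.span ℝ (Set.range e)).topologicalClosure = V 0

/-! ### Hermite cubic splines -/

/-- The Hermite cubic spline `ξ₁`. -/
def hermite1 (x : ℝ) : ℝ :=
  if -1 ≤ x ∧ x ≤ 0 then (x + 1) ^ 2 * (1 - 2 * x)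
  else if 0 ≤ x ∧ x ≤ 1 then (1 - x) ^ 2 * (1 + 2 * x)
  else 0

/-- The Hermite cubic spline `ξ₂`. -/
def hermite2 (x : ℝ) : ℝ :=
  if -1 ≤ x ∧ x ≤ 0 then (x + 1) ^ 2 * x
  else if 0 ≤ x ∧ x ≤ 1 then (1 - x) ^ 2 * x
  else 0

/-- The functions `ξ_{j,n}`, where `ξ_{j,2k+l-1}(x) = 2^{j/2} ξ_l(2^j x - k)` for `l = 1, 2`. -/
def xi (j n : ℤ) (x : ℝ) : ℝ :=
  (2 : ℝ) ^ ((j : ℝ) / 2) *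
    (if n % 2 = 0 then hermite1 else hermite2) ((2 : ℝ) ^ j * x - ((n / 2 : ℤ) : ℝ))

/-- The Hermite cubic spline spaces `Ṽ_j`. -/
def hermiteSpace (j : ℤ) : Submodule ℝ L2R := closedSpan (xi j)

/-! ### Spaces of splines on the unit interval -/

/-- `f χ_{[0,1]}`. -/
def restrict (f : ℝ → ℝ) : ℝ → ℝ := (Set.Icc (0 : ℝ) 1).indicator f

def spaceA0 : Submodule ℝ (ℝ → ℝ) := Submodule.span ℝ {xi 1 2, xi 1 3}

def spaceA1 : Submodule ℝ (ℝ → ℝ) := Submodule.span ℝ (xi 2 '' Set.Icc 2 7)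

def spaceB0 : Submodule ℝ (ℝ → ℝ) :=
  Submodule.span ℝ ({restrict (xi 1 0), restrict (xi 1 1)} ∪ (spaceA0 : Set (ℝ → ℝ)))

def spaceB1 : Submodule ℝ (ℝ → ℝ) :=
  Submodule.span ℝ ({restrict (xi 1 4), restrict (xi 1 5)} ∪ (spaceA0 : Set (ℝ → ℝ)))

/-- The orthogonal complement `A ⊖ B` of `B` in `A`. -/
def ominus (A B : Submodule ℝ (ℝ → ℝ)) : Set (ℝ → ℝ) :=
  {f | f ∈ A ∧ ∀ g ∈ B, ip f g = 0}

def spaceC0 : Set (ℝ → ℝ) := ominus spaceB0 spaceA0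

def spaceC1 : Set (ℝ → ℝ) := ominus spaceB1 spaceA0

/-- `p` is the orthogonal projection of `f` onto `W`. -/
def IsProj (W : Submodule ℝ (ℝ → ℝ)) (f p : ℝ → ℝ) : Prop :=
  p ∈ W ∧ ∀ w ∈ W, ip (f - p) w = 0

/-- `(I - P_W) C₀ ⊥ (I - P_W) C₁`. -/
def ProjCondition (W : Submodule ℝ (ℝ → ℝ)) : Prop :=
  ∀ u ∈ spaceC0, ∀ v ∈ spaceC1, ∀ p q : ℝ → ℝ,
    IsProj W u p → IsProj W v q → ip (u - p) (v - q) = 0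

/-- `f3, f4` are an admissible choice of the generators `φ₃, φ₄`: an orthonormal basis of a subspace
`W` of `A₁ ⊖ A₀` with `(I - P_W) C₀ ⊥ (I - P_W) C₁`. -/
structure IsAdmissible (f3 f4 : ℝ → ℝ) : Prop where
  norm3 : ip f3 f3 = 1
  norm4 : ip f4 f4 = 1
  orth : ip f3 f4 = 0
  subset : (Submodule.span ℝ {f3, f4} : Set (ℝ → ℝ)) ⊆ ominus spaceA1 spaceA0
  cond : ProjCondition (Submodule.span ℝ {f3, f4})

/-! ### The scaling generators and the multiresolution spaces -/

def normalize (f : ℝ → ℝ) : ℝ → ℝ := (l2norm f)⁻¹ • f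

def phi1 : ℝ → ℝ := normalize (xi 1 2)

def phi2 : ℝ → ℝ := normalize (xi 1 3)

/-- `f (· + 1)`. -/
def shift (f : ℝ → ℝ) (x : ℝ) : ℝ := f (x + 1)

/-- `f - ∑_j ⟨f, u_j⟩ u_j - ∑_j ⟨f, u_j(· + 1)⟩ u_j(· + 1)`. -/
def residual {m : ℕ} (u : Fin m → ℝ → ℝ) (f : ℝ → ℝ) : ℝ → ℝ :=
  f - ∑ j, ip f (u j) • u j - ∑ j, ip f (shift (u j)) • shift (u j)

def phi5 (f3 f4 : ℝ → ℝ) : ℝ → ℝ :=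
  normalize (residual ![phi1, phi2, f3, f4] (xi 1 0))

def phi6 (f3 f4 : ℝ → ℝ) : ℝ → ℝ :=
  normalize (residual ![phi1, phi2, f3, f4, phi5 f3 f4] (xi 1 1))

/-- The six scaling generators `φ₁, …, φ₆` (indexed from `0`), given `φ₃ = f3` and `φ₄ = f4`. -/
def generators (f3 f4 : ℝ → ℝ) : Fin 6 → ℝ → ℝ :=
  ![phi1, phi2, f3, f4, phi5 f3 f4, phi6 f3 f4]

/-- The scaling functions `φ_{j,n}`, where `φ_{j,6k+l}(x) = 2^{j/2} φ_l(2^j x - k)` for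
`l = 1, 2, 3, 4` and `φ_{j,6k+l}(x) = 2^{j/2} φ_l(2^j x - k - 1)` for `l = 5, 6`. -/
def scalingFun (φ : Fin 6 → ℝ → ℝ) (j n : ℤ) (x : ℝ) : ℝ :=
  (2 : ℝ) ^ ((j : ℝ) / 2) *
    φ (Fin.ofNat 6 ((n - 1) % 6).toNat)
      ((2 : ℝ) ^ j * x - (((n - 1) / 6 : ℤ) : ℝ) - (if (n - 1) % 6 < 4 then 0 else 1))

/-- The multiresolution spaces `V_j`. -/
def scalingSpace (φ : Fin 6 → ℝ → ℝ) (j : ℤ) : Submodule ℝ L2R := closedSpan (scalingFun φ j)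

end SplineMRA

end

noncomputable section

namespace SplineMRA

/-! ### The inner product on square integrable functions -/

/-! The construction reduces orthogonality to a condition on one unit interval. The generators `φ₁,
…, φ₄` vanish outside `[0, 1]` and `φ₅, φ₆` outside `[-1, 1]`. After the projections built into `φ₅,
φ₆`, the only overlap still to be handled is that of `φ₅, φ₆` with their neighbours at distance one.
On the common unit interval one factor comes from `(I - P_W) C₀` and the other from `(I - P_W) C₁`,
so admissibility gives orthogonality (`IsAdmissible.ip_sub_proj_eq_zero`,
`IsAdmissible.ip_residual_residual_sub_one`). The normalizations make sense because `g₅(0) = √2` and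
`g₆'(0) = 2√2`: the functions subtracted from `ξ_{1,0}` vanish at `0`, and those subtracted from
`ξ_{1,1}` have derivative zero there.

Existence of admissible pairs is a matrix problem. Take a basis of `W` whose inner products with the
left boundary functions `ξ₁(2x)`, `ξ₂(2x)` form the identity matrix, and with the right ones `ξ₁(2x
- 2)`, `-ξ₂(2x - 2)` a `2 × 2` matrix `Z`. If `G(Z)` is the Gram matrix of this basis and `M` the
matrix of the pairing of `C₀` with `C₁`, it suffices that `G(Z) M = Zᵀ`. This is a Riccati equation,
since `G` is quadratic in `Z`. It reduces to intersecting an ellipse with a line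
(`exists_line_inter_ellipse`, `exists_riccati_solution`, `exists_isAdmissible`).

The multiresolution properties follow from `Ṽ₁ ⊂ V₀ ⊂ Ṽ₂`: the first inclusion inverts the
Gram-Schmidt steps, the second is the refinement of Hermite splines. Dilation yields `V_j ⊂ Ṽ_{j+2}
⊂ V_{j+1}`, hence nestedness. Density is inherited from the Hermite spaces, where a
quasi-interpolant approximates continuous functions of compact support (`eq_zero_of_ip_xi_eq_zero`).
The intersection is trivial because a function in `V₀` is bounded by a constant times its norm,
while dilation shrinks the `L¹` norm of a test function relative to its `L²` norm
(`iInf_scalingSpace_eq_bot`). -/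

theorem ip_comm (f g : ℝ → ℝ) : ip f g = ip g f := by
  simp only [ip, mul_comm]

theorem integrable_mul_of_memLp {f g : ℝ → ℝ} (hf : MemLp f 2 volume) (hg : MemLp g 2 volume) :
    Integrable (fun x => f x * g x) := hf.integrable_mul hg

theorem ip_add_left {f g h : ℝ → ℝ} (hf : MemLp f 2 volume) (hg : MemLp g 2 volume)
    (hh : MemLp h 2 volume) : ip (f + g) h = ip f h + ip g h := by
  simp only [ip, Pi.add_apply, add_mul]
  exact integral_add (integrable_mul_of_memLp hf hh) (integrable_mul_of_memLp hg hh)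

theorem ip_sub_left {f g h : ℝ → ℝ} (hf : MemLp f 2 volume) (hg : MemLp g 2 volume)
    (hh : MemLp h 2 volume) : ip (f - g) h = ip f h - ip g h := by
  simp only [ip, Pi.sub_apply, sub_mul]
  exact integral_sub (integrable_mul_of_memLp hf hh) (integrable_mul_of_memLp hg hh)

theorem ip_smul_left (c : ℝ) (f g : ℝ → ℝ) : ip (c • f) g = c * ip f g := by
  simp only [ip, Pi.smul_apply, smul_eq_mul, mul_assoc]
  exact integral_const_mul _ _

theorem ip_smul_right (c : ℝ) (f g : ℝ → ℝ) : ip f (c • g) = c * ip f g := by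
  rw [ip_comm, ip_smul_left, ip_comm]

theorem ip_add_right {f g h : ℝ → ℝ} (hf : MemLp f 2 volume) (hg : MemLp g 2 volume)
    (hh : MemLp h 2 volume) : ip h (f + g) = ip h f + ip h g := by
  rw [ip_comm, ip_add_left hf hg hh, ip_comm f, ip_comm g]

theorem ip_sub_right {f g h : ℝ → ℝ} (hf : MemLp f 2 volume) (hg : MemLp g 2 volume)
    (hh : MemLp h 2 volume) : ip h (f - g) = ip h f - ip h g := by
  rw [ip_comm, ip_sub_left hf hg hh, ip_comm f, ip_comm g]

theorem ip_sum_left {ι : Type*} (s : Finset ι) {f : ι → ℝ → ℝ} {h : ℝ → ℝ}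
    (hf : ∀ i ∈ s, MemLp (f i) 2 volume) (hh : MemLp h 2 volume) :
    ip (∑ i ∈ s, f i) h = ∑ i ∈ s, ip (f i) h := by
  simp only [ip, Finset.sum_apply, Finset.sum_mul]
  exact integral_finsetSum _ fun i hi => integrable_mul_of_memLp (hf i hi) hh

theorem ip_eq_zero_of_mul_eq_zero {f g : ℝ → ℝ} (h : ∀ x, f x * g x = 0) : ip f g = 0 := by
  simp [ip, h]

theorem ip_comp_sub (f g : ℝ → ℝ) (a : ℝ) :
    ip (fun x => f (x - a)) (fun x => g (x - a)) = ip f g :=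
  integral_sub_right_eq_self (fun x => f x * g x) a

theorem ip_sub_int (f g : ℝ → ℝ) (a b : ℝ) :
    ip (fun x => f (x - a)) (fun x => g (x - b)) = ip f (fun x => g (x - (b - a))) := by
  rw [← ip_comp_sub f _ a]
  congr 1
  funext x
  congr 1
  ring

theorem inner_eq_ip (f g : L2R) : inner ℝ f g = ip f g := by
  rw [L2.inner_def, ip]
  refine integral_congr_ae (Filter.Eventually.of_forall fun x => ?_)
  simp [mul_comm]

theorem ip_congr_ae {f f' g g' : ℝ → ℝ} (hf : f =ᵐ[volume] f') (hg : g =ᵐ[volume] g') :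
    ip f g = ip f' g' := by
  refine integral_congr_ae ?_
  filter_upwards [hf, hg] with x h1 h2
  rw [h1, h2]

theorem ip_self_pos {f : ℝ → ℝ} (hf : Continuous f) (hc : HasCompactSupport f) {x : ℝ}
    (hx : f x ≠ 0) : 0 < ip f f :=
  (hf.mul hf).integral_pos_of_hasCompactSupport_nonneg_nonzero (hc.mul_left)
    (fun y => mul_self_nonneg (f y)) (mul_self_ne_zero.2 hx)

theorem ip_normalize_self {f : ℝ → ℝ} (hf : 0 < ip f f) : ip (normalize f) (normalize f) = 1 := by
  have h := Real.sq_sqrt hf.le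
  have h' : Real.sqrt (ip f f) ≠ 0 := (Real.sqrt_pos.2 hf).ne'
  rw [normalize, ip_smul_left, ip_smul_right, l2norm]
  field_simp
  exact h.symm

/-! ### Truncated powers -/

/-- The truncated power `(x - a)₊ⁿ`. -/
def truncPow (a : ℝ) (n : ℕ) (x : ℝ) : ℝ := max (x - a) 0 ^ n

/-- Since `y₊² = (y² + y|y|) / 2`, this derivative is the source of the `C¹` regularity of all
splines below. -/
theorem hasDerivAt_mul_abs (x : ℝ) : HasDerivAt (fun y : ℝ => y * |y|) (2 * |x|) x := by
  rcases eq_or_ne x 0 with rfl | hx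
  · rw [hasDerivAt_iff_isLittleO]
    simp only [abs_zero, mul_zero, sub_zero, smul_zero]
    rw [Asymptotics.isLittleO_iff]
    intro c hc
    filter_upwards [Metric.ball_mem_nhds (0 : ℝ) hc] with y hy
    rw [norm_mul, Real.norm_eq_abs, Real.norm_eq_abs, abs_abs, mul_comm]
    have : |y| ≤ c := by simpa using (Metric.mem_ball.1 hy).le
    exact mul_le_mul_of_nonneg_right this (abs_nonneg y)
  · have := (hasDerivAt_id x).mul (hasDerivAt_abs hx)
    refine this.congr_deriv ?_
    simp only [id, one_mul]
    rcases hx.lt_or_gt with h | h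
    · simp [h, abs_of_neg h]; ring
    · simp [h, abs_of_pos h]; ring

theorem contDiff_mul_abs : ContDiff ℝ 1 fun y : ℝ => y * |y| := by
  rw [contDiff_one_iff_deriv]
  refine ⟨fun x => (hasDerivAt_mul_abs x).differentiableAt, ?_⟩
  have : deriv (fun y : ℝ => y * |y|) = fun x => 2 * |x| := funext fun x =>
    (hasDerivAt_mul_abs x).deriv
  rw [this]
  fun_prop

theorem max_zero_sq (y : ℝ) : max y 0 ^ 2 = (y ^ 2 + y * |y|) / 2 := by
  rcases le_total 0 y with h | h
  · rw [max_eq_left h, abs_of_nonneg h]; ring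
  · rw [max_eq_right h, abs_of_nonpos h]; ring

theorem max_zero_cube (y : ℝ) : max y 0 ^ 3 = y * max y 0 ^ 2 := by
  rcases le_total 0 y with h | h
  · rw [max_eq_left h]; ring
  · rw [max_eq_right h]; ring

theorem contDiff_truncPow_two (a : ℝ) : ContDiff ℝ 1 (truncPow a 2) := by
  have h : truncPow a 2 = fun x => ((x - a) ^ 2 + (fun y : ℝ => y * |y|) (x - a)) / 2 :=
    funext fun x => max_zero_sq _
  rw [h]
  have := contDiff_mul_abs.comp (contDiff_id.sub contDiff_const : ContDiff ℝ 1 fun x : ℝ => x - a)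
  exact (((contDiff_id.sub contDiff_const).pow 2).add this).div_const 2

theorem contDiff_truncPow_three (a : ℝ) : ContDiff ℝ 1 (truncPow a 3) := by
  have h : truncPow a 3 = fun x => (x - a) * truncPow a 2 x := funext fun x => max_zero_cube _
  rw [h]
  exact (contDiff_id.sub contDiff_const).mul (contDiff_truncPow_two a)

/-! ### Cubic splines -/

theorem IsCubicSpline.add {f g : ℝ → ℝ} (hf : IsCubicSpline f) (hg : IsCubicSpline g) :
    IsCubicSpline (f + g) := by
  obtain ⟨s, hs⟩ := hf
  obtain ⟨t, ht⟩ := hg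
  refine ⟨s ∪ t, fun I hI hd => ?_⟩
  rw [Finset.coe_union, Set.disjoint_union_right] at hd
  obtain ⟨p, hp, hp'⟩ := hs I hI hd.1
  obtain ⟨q, hq, hq'⟩ := ht I hI hd.2
  exact ⟨p + q, Polynomial.natDegree_add_le_of_degree_le hp hq, fun x hx => by
    simp [hp' x hx, hq' x hx]⟩

theorem IsCubicSpline.smul {f : ℝ → ℝ} (c : ℝ) (hf : IsCubicSpline f) :
    IsCubicSpline (c • f) := by
  obtain ⟨s, hs⟩ := hf
  refine ⟨s, fun I hI hd => ?_⟩
  obtain ⟨p, hp, hp'⟩ := hs I hI hd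
  exact ⟨c • p, (Polynomial.natDegree_smul_le c p).trans hp, fun x hx => by simp [hp' x hx]⟩

theorem isCubicSpline_zero : IsCubicSpline 0 :=
  ⟨∅, fun _ _ _ => ⟨0, by simp, by simp⟩⟩

theorem IsCubicSpline.comp_affine {f : ℝ → ℝ} (hf : IsCubicSpline f) {a : ℝ} (ha : 0 < a) (b : ℝ) :
    IsCubicSpline fun x => f (a * x - b) := by
  obtain ⟨s, hs⟩ := hf
  refine ⟨s.image fun y => (y + b) / a, fun I hI hd => ?_⟩
  have hI' : ((fun x => a * x - b) '' I).OrdConnected := by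
    refine ⟨?_⟩
    rintro _ ⟨x, hx, rfl⟩ _ ⟨y, hy, rfl⟩ z ⟨hz1, hz2⟩
    refine ⟨(z + b) / a, hI.out hx hy ⟨?_, ?_⟩, by field_simp; ring⟩
    · rw [le_div_iff₀ ha]; simp only at hz1; linarith
    · rw [div_le_iff₀ ha]; simp only at hz2; linarith
  have hd' : Disjoint ((fun x => a * x - b) '' I) (s : Set ℝ) := by
    rw [Set.disjoint_left]
    rintro _ ⟨x, hx, rfl⟩ hxs
    refine Set.disjoint_left.1 hd hx ?_
    rw [Finset.coe_image]
    exact ⟨_, hxs, by field_simp; ring⟩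
  obtain ⟨p, hp, hp'⟩ := hs _ hI' hd'
  refine ⟨p.comp (Polynomial.C a * Polynomial.X - Polynomial.C b), ?_, fun x hx => ?_⟩
  · refine Polynomial.natDegree_comp_le.trans ?_
    have : (Polynomial.C a * Polynomial.X - Polynomial.C b).natDegree ≤ 1 := by compute_degree
    nlinarith [Nat.zero_le p.natDegree]
  · simpa using hp' _ ⟨x, hx, rfl⟩

theorem isCubicSpline_truncPow (a : ℝ) {n : ℕ} (hn : n ≤ 3) (hn0 : n ≠ 0) :
    IsCubicSpline (truncPow a n) := by
  refine ⟨{a}, fun I hI hd => ?_⟩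
  rw [Finset.coe_singleton, Set.disjoint_singleton_right] at hd
  by_cases h : ∃ y ∈ I, y < a
  · obtain ⟨y, hy, hya⟩ := h
    refine ⟨0, by simp, fun x hx => ?_⟩
    have : x ≤ a := by
      by_contra! hc
      exact hd (hI.out hy hx ⟨hya.le, hc.le⟩)
    simp [truncPow, this, hn0]
  · push Not at h
    refine ⟨(Polynomial.X - Polynomial.C a) ^ n, ?_, fun x hx => ?_⟩
    · rw [Polynomial.natDegree_pow, Polynomial.natDegree_X_sub_C, mul_one]; exact hn
    · simp [truncPow, h x hx]

/-! ### Hermite cubic splines -/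

theorem hermite1_left {x : ℝ} (h : -1 ≤ x) (h' : x ≤ 0) :
    hermite1 x = (x + 1) ^ 2 * (1 - 2 * x) := by simp [hermite1, h, h']

theorem hermite1_right {x : ℝ} (h : 0 ≤ x) (h' : x ≤ 1) :
    hermite1 x = (1 - x) ^ 2 * (1 + 2 * x) := by
  unfold hermite1
  split_ifs with h1 h2
  · have : x = 0 := le_antisymm h1.2 h
    simp [this]
  · rfl
  · exact absurd ⟨h, h'⟩ h2

theorem hermite1_le {x : ℝ} (h : x ≤ -1) : hermite1 x = 0 := by
  rcases h.eq_or_lt with rfl | h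
  · norm_num [hermite1]
  · rw [hermite1, if_neg (by intro h'; linarith [h'.1]), if_neg (by intro h'; linarith [h'.1])]

theorem hermite1_ge {x : ℝ} (h : 1 ≤ x) : hermite1 x = 0 := by
  rcases h.eq_or_lt with rfl | h
  · norm_num [hermite1]
  · rw [hermite1, if_neg (by intro h'; linarith [h'.2]), if_neg (by intro h'; linarith [h'.2])]

theorem hermite2_left {x : ℝ} (h : -1 ≤ x) (h' : x ≤ 0) :
    hermite2 x = (x + 1) ^ 2 * x := by simp [hermite2, h, h']

theorem hermite2_right {x : ℝ} (h : 0 ≤ x) (h' : x ≤ 1) :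
    hermite2 x = (1 - x) ^ 2 * x := by
  unfold hermite2
  split_ifs with h1 h2
  · have : x = 0 := le_antisymm h1.2 h
    simp [this]
  · rfl
  · exact absurd ⟨h, h'⟩ h2

theorem hermite2_le {x : ℝ} (h : x ≤ -1) : hermite2 x = 0 := by
  rcases h.eq_or_lt with rfl | h
  · norm_num [hermite2]
  · rw [hermite2, if_neg (by intro h'; linarith [h'.1]), if_neg (by intro h'; linarith [h'.1])]

theorem hermite2_ge {x : ℝ} (h : 1 ≤ x) : hermite2 x = 0 := by
  rcases h.eq_or_lt with rfl | h
  · norm_num [hermite2]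
  · rw [hermite2, if_neg (by intro h'; linarith [h'.2]), if_neg (by intro h'; linarith [h'.2])]

theorem real_cases (x : ℝ) : x ≤ -1 ∨ (-1 ≤ x ∧ x ≤ 0) ∨ (0 ≤ x ∧ x ≤ 1) ∨ 1 ≤ x := by
  rcases le_total x (-1) with h | h
  · exact .inl h
  rcases le_total x 0 with h' | h'
  · exact .inr (.inl ⟨h, h'⟩)
  rcases le_total x 1 with h'' | h''
  · exact .inr (.inr (.inl ⟨h', h''⟩))
  · exact .inr (.inr (.inr h''))

/-- The coefficients are the jumps of the quadratic and cubic Taylor coefficients at the knots `-1,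
0, 1`. Only powers two and three occur, and these are `C¹`, so no matching of one-sided derivatives
is needed. -/
theorem hermite1_eq_truncPow : hermite1 =
    (3 : ℝ) • truncPow (-1) 2 + (-2 : ℝ) • truncPow (-1) 3 + (4 : ℝ) • truncPow 0 3 +
      (-3 : ℝ) • truncPow 1 2 + (-2 : ℝ) • truncPow 1 3 := by
  funext x
  simp only [Pi.add_apply, Pi.smul_apply, smul_eq_mul, truncPow, sub_zero]
  rcases real_cases x with h | ⟨h, h'⟩ | ⟨h, h'⟩ | h
  · rw [hermite1_le h, max_eq_right (by linarith), max_eq_right (by linarith),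
      max_eq_right (by linarith)]; ring
  · rw [hermite1_left h h', max_eq_left (by linarith), max_eq_right (by linarith),
      max_eq_right (by linarith)]; ring
  · rw [hermite1_right h h', max_eq_left (by linarith), max_eq_left (by linarith),
      max_eq_right (by linarith)]; ring
  · rw [hermite1_ge h, max_eq_left (by linarith), max_eq_left (by linarith),
      max_eq_left (by linarith)]; ring

theorem hermite2_eq_truncPow : hermite2 =
    (-1 : ℝ) • truncPow (-1) 2 + (1 : ℝ) • truncPow (-1) 3 + (-4 : ℝ) • truncPow 0 2 +
      (-1 : ℝ) • truncPow 1 2 + (-1 : ℝ) • truncPow 1 3 := by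
  funext x
  simp only [Pi.add_apply, Pi.smul_apply, smul_eq_mul, truncPow, sub_zero]
  rcases real_cases x with h | ⟨h, h'⟩ | ⟨h, h'⟩ | h
  · rw [hermite2_le h, max_eq_right (by linarith), max_eq_right (by linarith),
      max_eq_right (by linarith)]; ring
  · rw [hermite2_left h h', max_eq_left (by linarith), max_eq_right (by linarith),
      max_eq_right (by linarith)]; ring
  · rw [hermite2_right h h', max_eq_left (by linarith), max_eq_left (by linarith),
      max_eq_right (by linarith)]; ring
  · rw [hermite2_ge h, max_eq_left (by linarith), max_eq_left (by linarith),
      max_eq_left (by linarith)]; ring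

/-- The continuously differentiable cubic splines. -/
def c1Splines : Submodule ℝ (ℝ → ℝ) where
  carrier := {f | IsCubicSpline f ∧ ContDiff ℝ 1 f}
  add_mem' hf hg := ⟨hf.1.add hg.1, hf.2.add hg.2⟩
  zero_mem' := ⟨isCubicSpline_zero, contDiff_const⟩
  smul_mem' c _ hf := ⟨hf.1.smul c, hf.2.const_smul c⟩

theorem truncPow_two_mem (a : ℝ) : truncPow a 2 ∈ c1Splines :=
  ⟨isCubicSpline_truncPow a (by norm_num) (by norm_num), contDiff_truncPow_two a⟩

theorem truncPow_three_mem (a : ℝ) : truncPow a 3 ∈ c1Splines :=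
  ⟨isCubicSpline_truncPow a le_rfl (by norm_num), contDiff_truncPow_three a⟩

theorem hermite1_mem : hermite1 ∈ c1Splines := by
  rw [hermite1_eq_truncPow]
  exact add_mem (add_mem (add_mem (add_mem
    (Submodule.smul_mem _ _ (truncPow_two_mem _)) (Submodule.smul_mem _ _ (truncPow_three_mem _)))
    (Submodule.smul_mem _ _ (truncPow_three_mem _))) (Submodule.smul_mem _ _ (truncPow_two_mem _)))
    (Submodule.smul_mem _ _ (truncPow_three_mem _))

theorem hermite2_mem : hermite2 ∈ c1Splines := by
  rw [hermite2_eq_truncPow]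
  exact add_mem (add_mem (add_mem (add_mem
    (Submodule.smul_mem _ _ (truncPow_two_mem _)) (Submodule.smul_mem _ _ (truncPow_three_mem _)))
    (Submodule.smul_mem _ _ (truncPow_two_mem _))) (Submodule.smul_mem _ _ (truncPow_two_mem _)))
    (Submodule.smul_mem _ _ (truncPow_three_mem _))

theorem comp_affine_mem_c1Splines {f : ℝ → ℝ} (hf : f ∈ c1Splines) {a : ℝ} (ha : 0 < a) (b : ℝ) :
    (fun x => f (a * x - b)) ∈ c1Splines :=
  ⟨hf.1.comp_affine ha b, hf.2.comp ((contDiff_const.mul contDiff_id).sub contDiff_const)⟩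

theorem xi_mem_c1Splines (j n : ℤ) : xi j n ∈ c1Splines := by
  have h : xi j n = (2 : ℝ) ^ ((j : ℝ) / 2) • fun x =>
      (if n % 2 = 0 then hermite1 else hermite2) ((2 : ℝ) ^ j * x - ((n / 2 : ℤ) : ℝ)) := rfl
  rw [h]
  refine Submodule.smul_mem _ _ (comp_affine_mem_c1Splines ?_ (by positivity) _)
  split_ifs
  · exact hermite1_mem
  · exact hermite2_mem

/-- The functions that vanish outside `(a, b)`. -/
def supportedIn (a b : ℝ) : Submodule ℝ (ℝ → ℝ) where
  carrier := {f | ∀ x, x ≤ a ∨ b ≤ x → f x = 0}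
  add_mem' hf hg x hx := by simp [hf x hx, hg x hx]
  zero_mem' _ _ := rfl
  smul_mem' c f hf x hx := by simp [hf x hx]

theorem hermite1_supportedIn : hermite1 ∈ supportedIn (-1) 1 := fun _ hx =>
  hx.elim hermite1_le hermite1_ge

theorem hermite2_supportedIn : hermite2 ∈ supportedIn (-1) 1 := fun _ hx =>
  hx.elim hermite2_le hermite2_ge

theorem xi_supportedIn (j n : ℤ) {a b : ℝ} (ha : (2 : ℝ) ^ j * a ≤ ((n / 2 : ℤ) : ℝ) - 1)
    (hb : ((n / 2 : ℤ) : ℝ) + 1 ≤ (2 : ℝ) ^ j * b) : xi j n ∈ supportedIn a b := by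
  intro x hx
  have hpos : (0 : ℝ) < (2 : ℝ) ^ j := by positivity
  have key : (2 : ℝ) ^ j * x - ((n / 2 : ℤ) : ℝ) ≤ -1 ∨
      1 ≤ (2 : ℝ) ^ j * x - ((n / 2 : ℤ) : ℝ) := by
    rcases hx with hx | hx
    · left; nlinarith
    · right; nlinarith
  unfold xi
  split_ifs
  · rw [hermite1_supportedIn _ key, mul_zero]
  · rw [hermite2_supportedIn _ key, mul_zero]

theorem hasCompactSupport_of_supportedIn {f : ℝ → ℝ} {a b : ℝ} (hf : f ∈ supportedIn a b) :
    HasCompactSupport f :=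
  HasCompactSupport.intro (isCompact_Icc (a := a) (b := b)) fun x hx => by
    apply hf x
    by_contra! h
    exact hx ⟨h.1.le, h.2.le⟩

theorem memLp_of_c1Splines {f : ℝ → ℝ} (hf : f ∈ c1Splines) {a b : ℝ} (hs : f ∈ supportedIn a b) :
    MemLp f 2 volume :=
  hf.2.continuous.memLp_of_hasCompactSupport (hasCompactSupport_of_supportedIn hs)

theorem memLp_xi (j n : ℤ) : MemLp (xi j n) 2 volume := by
  have hpos : (2 : ℝ) ^ j ≠ 0 := by positivity
  refine memLp_of_c1Splines (xi_mem_c1Splines j n) (xi_supportedIn j n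
    (a := (2 ^ j)⁻¹ * (((n / 2 : ℤ) : ℝ) - 1)) (b := (2 ^ j)⁻¹ * (((n / 2 : ℤ) : ℝ) + 1)) ?_ ?_)
  · rw [mul_inv_cancel_left₀ hpos]
  · rw [mul_inv_cancel_left₀ hpos]

theorem xi_one (n : ℤ) : xi 1 n = Real.sqrt 2 • fun x =>
    (if n % 2 = 0 then hermite1 else hermite2) (2 * x - ((n / 2 : ℤ) : ℝ)) := by
  funext x
  simp [xi, Real.sqrt_eq_rpow]

theorem xi_two (n : ℤ) : xi 2 n = (2 : ℝ) • fun x =>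
    (if n % 2 = 0 then hermite1 else hermite2) (4 * x - ((n / 2 : ℤ) : ℝ)) := by
  funext x
  norm_num [xi]

/-! ### Piecewise cubic functions on the unit interval -/

/-- `f` vanishes outside `[0, 1]`, and on the quarter interval number `q` it is the cubic polynomial
in `4 x - q` with the coefficients `a q`. -/
structure Pieces (f : ℝ → ℝ) (a : Fin 4 → Fin 4 → ℝ) : Prop where
  zero : ∀ x, x ∉ Set.Icc (0 : ℝ) 1 → f x = 0
  poly : ∀ (q : Fin 4) (x : ℝ), (q : ℝ) / 4 < x → x < ((q : ℝ) + 1) / 4 →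
    f x = ∑ i : Fin 4, a q i * (4 * x - q) ^ (i : ℕ)

/-- The inner product of piecewise cubic functions in terms of their coefficients. -/
def pieceForm (a b : Fin 4 → Fin 4 → ℝ) : ℝ :=
  ∑ q : Fin 4, ∑ i : Fin 4, ∑ j : Fin 4, a q i * b q j / (4 * ((i : ℝ) + j + 1))

theorem integral_piece (q : Fin 4) (a b : Fin 4 → ℝ) :
    ∫ x in ((q : ℝ) / 4)..(((q : ℝ) + 1) / 4),
      (∑ i : Fin 4, a i * (4 * x - q) ^ (i : ℕ)) * (∑ i : Fin 4, b i * (4 * x - q) ^ (i : ℕ)) =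
    ∑ i : Fin 4, ∑ j : Fin 4, a i * b j / (4 * ((i : ℝ) + j + 1)) := by
  rw [intervalIntegral.integral_comp_mul_sub
    (fun u => (∑ i : Fin 4, a i * u ^ (i : ℕ)) * (∑ i : Fin 4, b i * u ^ (i : ℕ)))
    (by norm_num : (4 : ℝ) ≠ 0)]
  have h0 : 4 * ((q : ℝ) / 4) - q = 0 := by ring
  have h1 : 4 * (((q : ℝ) + 1) / 4) - q = 1 := by ring
  rw [h0, h1]
  have : (fun u : ℝ => (∑ i : Fin 4, a i * u ^ (i : ℕ)) * (∑ i : Fin 4, b i * u ^ (i : ℕ))) =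
      fun u => ∑ i : Fin 4, ∑ j : Fin 4, a i * b j * u ^ ((i : ℕ) + j) := by
    funext u
    rw [Finset.sum_mul_sum]
    refine Finset.sum_congr rfl fun i _ => Finset.sum_congr rfl fun j _ => ?_
    ring
  rw [this, intervalIntegral.integral_finsetSum fun i _ =>
    (Continuous.intervalIntegrable (by fun_prop) _ _)]
  rw [Finset.smul_sum]
  refine Finset.sum_congr rfl fun i _ => ?_
  rw [intervalIntegral.integral_finsetSum fun i _ =>
    (Continuous.intervalIntegrable (by fun_prop) _ _), Finset.smul_sum]
  refine Finset.sum_congr rfl fun j _ => ?_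
  rw [intervalIntegral.integral_const_mul, integral_pow]
  simp
  field_simp

/-- `Pieces` leaves the values at the knots free; they form a null set, so each quarter is replaced
by its interior before the polynomials are integrated. -/
theorem Pieces.ip_eq {f g : ℝ → ℝ} {a b : Fin 4 → Fin 4 → ℝ} (hf : Pieces f a)
    (hg : Pieces g b) : ip f g = pieceForm a b := by
  have h1 : ip f g = ∫ x in (0 : ℝ)..1, f x * g x := by
    rw [ip, intervalIntegral.integral_of_le zero_le_one, ← integral_Icc_eq_integral_Ioc,
      setIntegral_eq_integral_of_forall_compl_eq_zero]
    intro x hx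
    rw [hf.zero x hx, zero_mul]
  set F : Fin 4 → ℝ → ℝ := fun q x =>
    (∑ i : Fin 4, a q i * (4 * x - q) ^ (i : ℕ)) * (∑ i : Fin 4, b q i * (4 * x - q) ^ (i : ℕ))
    with hF
  have hcong : ∀ q : Fin 4, Set.EqOn (F q) (fun x => f x * g x)
      (Set.Ioo ((q : ℝ) / 4) (((q : ℝ) + 1) / 4)) := fun q x hx => by
    simp only [hF]
    rw [hf.poly q x hx.1 hx.2, hg.poly q x hx.1 hx.2]
  have hle : ∀ q : Fin 4, (q : ℝ) / 4 ≤ ((q : ℝ) + 1) / 4 := fun q => by linarith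
  have hint : ∀ q : Fin 4, IntervalIntegrable (fun x => f x * g x) volume ((q : ℝ) / 4)
      (((q : ℝ) + 1) / 4) := fun q => by
    have : IntervalIntegrable (F q) volume ((q : ℝ) / 4) (((q : ℝ) + 1) / 4) :=
      Continuous.intervalIntegrable (by fun_prop) _ _
    rw [intervalIntegrable_iff_integrableOn_Ioo_of_le (hle q)] at this ⊢
    exact this.congr_fun (hcong q) measurableSet_Ioo
  have hval : ∀ q : Fin 4, ∫ x in ((q : ℝ) / 4)..(((q : ℝ) + 1) / 4), f x * g x =
      ∑ i : Fin 4, ∑ j : Fin 4, a q i * b q j / (4 * ((i : ℝ) + j + 1)) := fun q => by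
    rw [← integral_piece q, intervalIntegral.integral_of_le (hle q),
      intervalIntegral.integral_of_le (hle q), integral_Ioc_eq_integral_Ioo,
      integral_Ioc_eq_integral_Ioo]
    exact (setIntegral_congr_fun measurableSet_Ioo (hcong q)).symm
  have hsum := intervalIntegral.sum_integral_adjacent_intervals (μ := volume)
    (f := fun x => f x * g x) (a := fun k : ℕ => (k : ℝ) / 4) (n := 4) fun k hk => by
      simpa using hint ⟨k, hk⟩
  rw [h1, pieceForm]
  simp only [Nat.cast_zero, zero_div, Nat.cast_ofNat, ne_eq, OfNat.ofNat_ne_zero,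
    not_false_eq_true, div_self] at hsum
  rw [← hsum, Finset.sum_range]
  refine Finset.sum_congr rfl fun q _ => ?_
  rw [← hval q]
  simp


/-! ### Splines with quarter knots in terms of nodal values and derivatives. -/

theorem hermite1_quarter {q : Fin 4} {x : ℝ} (h : (q : ℝ) / 4 < x) (h' : x < ((q : ℝ) + 1) / 4)
    (k : Fin 5) : hermite1 (4 * x - k) =
      if k = q.castSucc then 1 - 3 * (4 * x - q) ^ 2 + 2 * (4 * x - q) ^ 3
      else if k = q.succ then 3 * (4 * x - q) ^ 2 - 2 * (4 * x - q) ^ 3 else 0 := by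
  split_ifs with h1 h2
  · subst h1
    rw [Fin.val_castSucc, hermite1_right (by linarith) (by linarith)]
    ring
  · subst h2
    rw [Fin.val_succ]
    push_cast
    rw [hermite1_left (by linarith) (by linarith)]
    ring
  · rcases lt_trichotomy (k : ℕ) q with hk | hk | hk
    · have : (k : ℝ) + 1 ≤ q := by exact_mod_cast hk
      exact hermite1_ge (by linarith)
    · exact absurd (Fin.ext hk) h1
    · have hk' : (k : ℕ) ≠ q + 1 := fun h => h2 (Fin.ext (by simpa using h))
      have : (q : ℝ) + 2 ≤ k := by exact_mod_cast (by omega : (q : ℕ) + 2 ≤ k)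
      exact hermite1_le (by linarith)

theorem hermite2_quarter {q : Fin 4} {x : ℝ} (h : (q : ℝ) / 4 < x) (h' : x < ((q : ℝ) + 1) / 4)
    (k : Fin 5) : hermite2 (4 * x - k) =
      if k = q.castSucc then (4 * x - q) - 2 * (4 * x - q) ^ 2 + (4 * x - q) ^ 3
      else if k = q.succ then - (4 * x - q) ^ 2 + (4 * x - q) ^ 3 else 0 := by
  split_ifs with h1 h2
  · subst h1
    rw [Fin.val_castSucc, hermite2_right (by linarith) (by linarith)]
    ring
  · subst h2
    rw [Fin.val_succ]
    push_cast
    rw [hermite2_left (by linarith) (by linarith)]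
    ring
  · rcases lt_trichotomy (k : ℕ) q with hk | hk | hk
    · have : (k : ℝ) + 1 ≤ q := by exact_mod_cast hk
      exact hermite2_ge (by linarith)
    · exact absurd (Fin.ext hk) h1
    · have hk' : (k : ℕ) ≠ q + 1 := fun h => h2 (Fin.ext (by simpa using h))
      have : (q : ℝ) + 2 ≤ k := by exact_mod_cast (by omega : (q : ℕ) + 2 ≤ k)
      exact hermite2_le (by linarith)

/-- The `C¹` cubic spline with knots in `ℤ / 4`, with the values `v k` and the derivatives
`4 * d k` at the points `k / 4 ∈ [0, 1]`. -/
def nodal (v d : Fin 5 → ℝ) (x : ℝ) : ℝ :=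
  ∑ k : Fin 5, (v k * hermite1 (4 * x - k) + d k * hermite2 (4 * x - k))

theorem pieces_restrict_nodal (v d : Fin 5 → ℝ) : Pieces (restrict (nodal v d)) fun q =>
    ![v q.castSucc, d q.castSucc,
      -3 * v q.castSucc - 2 * d q.castSucc + 3 * v q.succ - d q.succ,
      2 * v q.castSucc + d q.castSucc - 2 * v q.succ + d q.succ] where
  zero x hx := Set.indicator_of_notMem hx _
  poly q x h h' := by
    have hq : (q : ℝ) + 1 ≤ 4 := by exact_mod_cast q.2
    have hq0 : (0 : ℝ) ≤ q := by positivity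
    have hx : x ∈ Set.Icc (0 : ℝ) 1 := ⟨by linarith, by linarith⟩
    have hne : q.succ ≠ q.castSucc := fun h => by
      have := congrArg Fin.val h
      simp at this
    rw [restrict, Set.indicator_of_mem hx, nodal, Finset.sum_add_distrib]
    simp only [hermite1_quarter h h', hermite2_quarter h h']
    generalize 4 * x - (q : ℝ) = u
    have key : ∀ (c : Fin 5 → ℝ) (r s : ℝ), ∑ k : Fin 5, c k *
        (if k = q.castSucc then r else if k = q.succ then s else 0) =
        c q.castSucc * r + c q.succ * s := fun c r s => by
      rw [Finset.sum_eq_add q.castSucc q.succ hne.symm]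
      · simp [hne]
      · rintro k - ⟨h1, h2⟩
        simp [h1, h2]
      · simp
      · simp
    rw [key, key, Fin.sum_univ_four]
    simp
    ring

/-- The inner product of two cubics on the unit interval in terms of their Hermite data. -/
def elementForm (v d v' d' w e w' e' : ℝ) : ℝ :=
  (156 * v * w + 22 * (v * e + d * w) + 54 * (v * w' + v' * w) - 13 * (v * e' + d' * w)
    + 4 * d * e + 13 * (d * w' + v' * e) - 3 * (d * e' + d' * e) + 156 * v' * w'
    - 22 * (v' * e' + d' * w') + 4 * d' * e') / 420

/-- The factor `1 / 4` is the length of a quarter interval, and `elementForm` is the mass matrix of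
the cubic Hermite element. Every inner product of explicit splines thereby becomes a rational
computation. -/
theorem ip_restrict_nodal (v d w e : Fin 5 → ℝ) :
    ip (restrict (nodal v d)) (restrict (nodal w e)) =
      (1 / 4) * ∑ q : Fin 4, elementForm (v q.castSucc) (d q.castSucc) (v q.succ) (d q.succ)
        (w q.castSucc) (e q.castSucc) (w q.succ) (e q.succ) := by
  rw [(pieces_restrict_nodal v d).ip_eq (pieces_restrict_nodal w e), pieceForm, Finset.mul_sum]
  refine Finset.sum_congr rfl fun q _ => ?_
  simp only [Fin.sum_univ_four, elementForm]
  simp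
  ring

/-! ### A quadratic system of equations -/

/-- The condition on `c` is the Cauchy-Schwarz bound for the linear form `a p + b q` on the ellipse.
The solution is the point of the line with least quadratic form, `(c / S) (a / d₁, b / d₂)`, moved
along the direction `(b, -a)` of the line by an amount `e` that supplies the missing `k - c² / S`.
-/
theorem exists_line_inter_ellipse {d₁ d₂ k a b c : ℝ} (h₁ : 0 < d₁) (h₂ : 0 < d₂)
    (hS : 0 < a ^ 2 / d₁ + b ^ 2 / d₂) (h : c ^ 2 ≤ k * (a ^ 2 / d₁ + b ^ 2 / d₂)) :
    ∃ p q : ℝ, d₁ * p ^ 2 + d₂ * q ^ 2 = k ∧ a * p + b * q = c := by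
  set S := a ^ 2 / d₁ + b ^ 2 / d₂ with hSdef
  have hS' : d₂ * a ^ 2 + d₁ * b ^ 2 = d₁ * d₂ * S := by rw [hSdef]; field_simp
  set e := Real.sqrt ((k - c ^ 2 / S) / (d₁ * d₂ * S)) with he
  have hk : 0 ≤ k - c ^ 2 / S := by rw [sub_nonneg, div_le_iff₀ hS]; exact h
  have he2 : e ^ 2 = (k - c ^ 2 / S) / (d₁ * d₂ * S) := Real.sq_sqrt (by positivity)
  have he3 : e ^ 2 * (d₁ * d₂ * S) = k - c ^ 2 / S := by rw [he2]; field_simp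
  refine ⟨c * a / (d₁ * S) + b * e, c * b / (d₂ * S) - a * e, ?_, ?_⟩
  · have h1 : d₁ * (c * a / (d₁ * S) + b * e) ^ 2 + d₂ * (c * b / (d₂ * S) - a * e) ^ 2 =
        c ^ 2 * (d₂ * a ^ 2 + d₁ * b ^ 2) / (d₁ * d₂ * S ^ 2) +
          e ^ 2 * (d₂ * a ^ 2 + d₁ * b ^ 2) := by
      field_simp
      ring
    rw [h1, hS', he3]
    field_simp
    ring
  · have h1 : a * (c * a / (d₁ * S) + b * e) + b * (c * b / (d₂ * S) - a * e) =
        c * (d₂ * a ^ 2 + d₁ * b ^ 2) / (d₁ * d₂ * S) := by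
      field_simp
      ring
    rw [h1, hS']
    field_simp

/-- The entry `(1, 1)` of the Gram matrix of two splines in dual coordinates. -/
def gram11 (z11 z21 : ℝ) : ℝ :=
  (2193568/4235) + (-1275664/4235) * z11 + (1698216/847) * z21 + (2193568/4235) * z11*z11 +
      (-4971304/847) * z11*z21 + (14498980/847) * z21*z21

/-- The entry `(1, 2)` of the Gram matrix of two splines in dual coordinates. -/
def gram12 (z11 z12 z21 z22 : ℝ) : ℝ :=
  (-2485652/847) + (-637832/4235) * z12 + (849108/847) * z11 + (849108/847) * z22 +
      (-5620900/847) * z21 + (2193568/4235) * z11*z12 + (-2485652/847) * z11*z22 +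
      (-2485652/847) * z12*z21 + (14498980/847) * z21*z22

/-- The entry `(2, 2)` of the Gram matrix of two splines in dual coordinates. -/
def gram22 (z12 z22 : ℝ) : ℝ :=
  (14498980/847) + (1698216/847) * z12 + (-11241800/847) * z22 + (2193568/4235) * z12*z12 +
      (-4971304/847) * z12*z22 + (14498980/847) * z22*z22

/-- In the Riccati system, `(p, q)` is the first column of `Z` after completing the square, the
ellipse is the equation for the entry `(1, 1)`, and the line is the difference of the two equations
for the off-diagonal entry. The number `t` measures the part of the second column that is orthogonal
to the first for the quadratic form. -/
theorem exists_conic_solution : ∃ t p q : ℝ, t ^ 2 = 30630287149/217154034329616596992 ∧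
    8774272/4235 * p ^ 2 + 72486430/36911 * q ^ 2 = 21252773734400/7248643 ∧
    (1819698960/2456173 + -51062249472/847 * t) * p + (-7464099360270/12951400229 +
        1809261292800/36911 * t) * q = 5881274880/7248643 := by
  -- With the negative root, the `t` term only increases the coefficient of `p`. The crude bound
  -- `700` is then enough for the ellipse criterion even when the contribution of `b` is dropped,
  -- and the square root need not be estimated.
  set r := Real.sqrt (30630287149/217154034329616596992) with hr
  obtain ⟨t, ht⟩ : ∃ t, t = -r := ⟨_, rfl⟩
  have ht2 : t ^ 2 = 30630287149/217154034329616596992 := by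
    rw [ht, neg_sq]
    exact Real.sq_sqrt (by norm_num)
  have ht0 : 0 ≤ r := Real.sqrt_nonneg _
  have ha : (700 : ℝ) ≤ 1819698960/2456173 + -51062249472/847 * t := by rw [ht]; linarith
  set a := 1819698960/2456173 + -51062249472/847 * t
  set b := -7464099360270/12951400229 + 1809261292800/36911 * t
  have ha2 : (700 : ℝ) ^ 2 / (8774272/4235) ≤ a ^ 2 / (8774272/4235) := by gcongr
  have hb2 : 0 ≤ b ^ 2 / (72486430/36911) := by positivity
  obtain ⟨p, q, h1, h2⟩ := exists_line_inter_ellipse (d₁ := 8774272/4235) (d₂ := 72486430/36911)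
    (k := 21252773734400/7248643) (a := a) (b := b) (c := 5881274880/7248643)
    (by norm_num) (by norm_num) (by norm_num at ha2 ⊢; linarith) (by norm_num at ha2 ⊢; linarith)
  exact ⟨t, p, q, ht2, h1, h2⟩

theorem exists_riccati_solution : ∃ z11 z12 z21 z22 : ℝ,
    (-24960) * z11 + 112320 * z21 = gram11 z11 z21 ∧
    (-24960) * z12 + 112320 * z22 = gram12 z11 z12 z21 z22 ∧
    112320 * z11 + (-504000) * z21 = gram12 z11 z12 z21 z22 ∧
    112320 * z12 + (-504000) * z22 = gram22 z12 z22 := by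
  -- In coordinates where the quadratic form is `d₁ p² + d₂ q²`, the second column is taken as a
  -- fixed multiple of `(p, q)` plus `t (-d₂ q, d₁ p)`. The multiple gives the right mixed product,
  -- and the quadratic form of the last vector is `t² d₁ d₂` times that of `(p, q)`, so the entry
  -- `(2, 2)` fixes `t²`.
  obtain ⟨t, p, q, ht, h1, hl⟩ := exists_conic_solution
  have h2 : 24123483904/5929 * (72486430/36911 * (t * q) ^ 2 + 8774272/4235 * (t * p) ^ 2) =
      4132944800/2456173 := by
    linear_combination 24123483904/5929 * t ^ 2 * h1 + 70729230988083200/5929 * ht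
  refine ⟨(-1402059803/7248643) + p + (239005/42184) * q,
    (6388803920/7248643) + (-1157071043/255441992) * p + (-21272751125555/828889614656) * q +
        (9942608/847) * t*p + (-72486430/36911) * t*q,
    (-217007518/7248643) + q,
    (991373723/7248643) + (-1157071043/255441992) * q + (8774272/4235) * t*p, ?_, ?_, ?_, ?_⟩
  · unfold gram11
    linear_combination (-1/4) * h1
  · unfold gram12
    linear_combination (1157071043/1021767968) * h1 + (1/2) * hl
  · unfold gram12
    linear_combination (1157071043/1021767968) * h1 + (-1/2) * hl
  · unfold gram22
    linear_combination (-1338813398549107849/261002445107712256) * h1 + (-1/4) * h2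

/-! ### Refinement of Hermite splines -/

/-- A Hermite spline is determined by its values and slopes at the knots: the coefficients are the
values of `ξ₁` at `-1/2, 0, 1/2` and half its derivatives there, the half coming from the dilation
by two. -/
theorem hermite1_refine (x : ℝ) : hermite1 x =
    1 / 2 * hermite1 (2 * x + 1) + 3 / 4 * hermite2 (2 * x + 1) + hermite1 (2 * x) +
      1 / 2 * hermite1 (2 * x - 1) - 3 / 4 * hermite2 (2 * x - 1) := by
  rcases le_total x 0 with h | h
  · rw [hermite1_le (by linarith : 2 * x - 1 ≤ -1), hermite2_le (by linarith : 2 * x - 1 ≤ -1)]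
    rcases le_total x (-1) with h1 | h1
    · rw [hermite1_le h1, hermite1_le (by linarith), hermite2_le (by linarith),
        hermite1_le (by linarith)]; ring
    rw [hermite1_left h1 h]
    rcases le_total x (-1 / 2) with h2 | h2
    · rw [hermite1_left (by linarith) (by linarith), hermite2_left (by linarith) (by linarith),
        hermite1_le (by linarith)]; ring
    · rw [hermite1_right (by linarith) (by linarith), hermite2_right (by linarith) (by linarith),
        hermite1_left (by linarith) (by linarith)]; ring
  · rw [hermite1_ge (by linarith : 1 ≤ 2 * x + 1), hermite2_ge (by linarith : 1 ≤ 2 * x + 1)]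
    rcases le_total 1 x with h1 | h1
    · rw [hermite1_ge h1, hermite1_ge (by linarith), hermite1_ge (by linarith),
        hermite2_ge (by linarith)]; ring
    rw [hermite1_right h h1]
    rcases le_total x (1 / 2) with h2 | h2
    · rw [hermite1_right (by linarith) (by linarith), hermite1_left (by linarith) (by linarith),
        hermite2_left (by linarith) (by linarith)]; ring
    · rw [hermite1_ge (by linarith), hermite1_right (by linarith) (by linarith),
        hermite2_right (by linarith) (by linarith)]; ring

theorem hermite2_refine (x : ℝ) : hermite2 x =
    -(1 / 8) * hermite1 (2 * x + 1) - 1 / 8 * hermite2 (2 * x + 1) + 1 / 2 * hermite2 (2 * x) +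
      1 / 8 * hermite1 (2 * x - 1) - 1 / 8 * hermite2 (2 * x - 1) := by
  rcases le_total x 0 with h | h
  · rw [hermite1_le (by linarith : 2 * x - 1 ≤ -1), hermite2_le (by linarith : 2 * x - 1 ≤ -1)]
    rcases le_total x (-1) with h1 | h1
    · rw [hermite2_le h1, hermite1_le (by linarith), hermite2_le (by linarith),
        hermite2_le (by linarith)]; ring
    rw [hermite2_left h1 h]
    rcases le_total x (-1 / 2) with h2 | h2
    · rw [hermite1_left (by linarith) (by linarith), hermite2_left (by linarith) (by linarith),
        hermite2_le (by linarith)]; ring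
    · rw [hermite1_right (by linarith) (by linarith), hermite2_right (by linarith) (by linarith),
        hermite2_left (by linarith) (by linarith)]; ring
  · rw [hermite1_ge (by linarith : 1 ≤ 2 * x + 1), hermite2_ge (by linarith : 1 ≤ 2 * x + 1)]
    rcases le_total 1 x with h1 | h1
    · rw [hermite2_ge h1, hermite2_ge (by linarith), hermite1_ge (by linarith),
        hermite2_ge (by linarith)]; ring
    rw [hermite2_right h h1]
    rcases le_total x (1 / 2) with h2 | h2
    · rw [hermite2_right (by linarith) (by linarith), hermite1_left (by linarith) (by linarith),
        hermite2_left (by linarith) (by linarith)]; ring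
    · rw [hermite2_ge (by linarith), hermite1_right (by linarith) (by linarith),
        hermite2_right (by linarith) (by linarith)]; ring

/-! ### The spaces of splines on the unit interval in coordinates -/

/-- The `C¹` cubic spline with knots in `ℤ / 2`, with the values `x₁`, `s`, `y₁` and the derivatives
`2 * x₂`, `2 * t`, `2 * y₂` at the points `0`, `1 / 2`, `1`. -/
def halfSpline (x₁ x₂ s t y₁ y₂ : ℝ) (x : ℝ) : ℝ :=
  x₁ * hermite1 (2 * x) + x₂ * hermite2 (2 * x) + s * hermite1 (2 * x - 1) +
    t * hermite2 (2 * x - 1) + y₁ * hermite1 (2 * x - 2) + y₂ * hermite2 (2 * x - 2)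

/-- This is the refinement relation applied to each of the six terms; the refined functions centred
at `-1/4` and `5/4` disappear on `[0, 1]`. It brings half-knot splines into the form required by
`ip_restrict_nodal`. -/
theorem restrict_halfSpline (x₁ x₂ s t y₁ y₂ : ℝ) : restrict (halfSpline x₁ x₂ s t y₁ y₂) =
    restrict (nodal
      ![x₁, x₁ / 2 + x₂ / 8 + s / 2 - t / 8, s, s / 2 + t / 8 + y₁ / 2 - y₂ / 8, y₁]
      ![x₂ / 2, -(3 / 4) * x₁ - x₂ / 8 + 3 / 4 * s - t / 8, t / 2,
        -(3 / 4) * s - t / 8 + 3 / 4 * y₁ - y₂ / 8, y₂ / 2]) := by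
  refine Set.indicator_congr fun x hx => ?_
  have e1 : 2 * (2 * x - 1) + 1 = 4 * x - 1 := by ring
  have e2 : 2 * (2 * x - 1) = 4 * x - 2 := by ring
  have e3 : 2 * (2 * x - 1) - 1 = 4 * x - 3 := by ring
  have e4 : 2 * (2 * x - 2) + 1 = 4 * x - 3 := by ring
  have e5 : 2 * (2 * x - 2) = 4 * x - 4 := by ring
  have e6 : 2 * (2 * x) = 4 * x := by ring
  rw [halfSpline, hermite1_refine (2 * x), hermite2_refine (2 * x), hermite1_refine (2 * x - 1),
    hermite2_refine (2 * x - 1), hermite1_refine (2 * x - 2), hermite2_refine (2 * x - 2),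
    hermite1_ge (by linarith [hx.1] : 1 ≤ 2 * (2 * x) + 1),
    hermite2_ge (by linarith [hx.1] : 1 ≤ 2 * (2 * x) + 1),
    hermite1_le (by linarith [hx.2] : 2 * (2 * x - 2) - 1 ≤ -1),
    hermite2_le (by linarith [hx.2] : 2 * (2 * x - 2) - 1 ≤ -1), e1, e3, e2, e4, e5, e6, nodal]
  simp [Fin.sum_univ_five]
  ring

theorem halfSpline_eq_zero {s t x : ℝ} (hx : x ∉ Set.Icc (0 : ℝ) 1) :
    halfSpline 0 0 s t 0 0 x = 0 := by
  have h : 2 * x - 1 ≤ -1 ∨ 1 ≤ 2 * x - 1 := by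
    by_contra! h
    exact hx ⟨by linarith [h.1], by linarith [h.2]⟩
  simp [halfSpline, hermite1_supportedIn _ h, hermite2_supportedIn _ h]

theorem restrict_halfSpline_mid (s t : ℝ) :
    restrict (halfSpline 0 0 s t 0 0) = halfSpline 0 0 s t 0 0 :=
  Set.indicator_eq_self.2 fun x hx => by
    by_contra h
    exact hx (halfSpline_eq_zero h)

theorem xi_one_apply_even (k : ℤ) (x : ℝ) :
    xi 1 (2 * k) x = Real.sqrt 2 * hermite1 (2 * x - k) := by
  simp [xi_one]

theorem xi_one_apply_odd (k : ℤ) (x : ℝ) :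
    xi 1 (2 * k + 1) x = Real.sqrt 2 * hermite2 (2 * x - k) := by
  have h : (2 * k + 1) / 2 = k := by omega
  simp [xi_one, h]

theorem xi_two_apply_even (k : ℤ) (x : ℝ) : xi 2 (2 * k) x = 2 * hermite1 (4 * x - k) := by
  simp [xi_two]

theorem xi_two_apply_odd (k : ℤ) (x : ℝ) : xi 2 (2 * k + 1) x = 2 * hermite2 (4 * x - k) := by
  have h : (2 * k + 1) / 2 = k := by omega
  simp [xi_two, h]

theorem mem_spaceA0_iff {f : ℝ → ℝ} : f ∈ spaceA0 ↔ ∃ s t, f = halfSpline 0 0 s t 0 0 := by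
  have h0 : Real.sqrt 2 ≠ 0 := by positivity
  have key : ∀ a b : ℝ, a • xi 1 2 + b • xi 1 3 =
      halfSpline 0 0 (a * Real.sqrt 2) (b * Real.sqrt 2) 0 0 := fun a b => by
    funext x
    have h2 := xi_one_apply_even 1 x
    have h3 := xi_one_apply_odd 1 x
    norm_num at h2 h3
    simp [h2, h3, halfSpline, mul_assoc]
  rw [spaceA0, Submodule.mem_span_pair]
  constructor
  · rintro ⟨a, b, rfl⟩
    exact ⟨_, _, key a b⟩
  · rintro ⟨s, t, rfl⟩
    exact ⟨s / Real.sqrt 2, t / Real.sqrt 2, by rw [key, div_mul_cancel₀ _ h0,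
      div_mul_cancel₀ _ h0]⟩

theorem exists_of_mem_spaceB0 {f : ℝ → ℝ} (hf : f ∈ spaceB0) :
    ∃ x₁ x₂ s t, f = restrict (halfSpline x₁ x₂ s t 0 0) := by
  rw [spaceB0, Submodule.span_union, Submodule.span_eq, Submodule.mem_sup] at hf
  obtain ⟨y, hy, z, hz, rfl⟩ := hf
  obtain ⟨a, b, rfl⟩ := Submodule.mem_span_pair.1 hy
  obtain ⟨s, t, rfl⟩ := mem_spaceA0_iff.1 hz
  refine ⟨a * Real.sqrt 2, b * Real.sqrt 2, s, t, ?_⟩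
  rw [← restrict_halfSpline_mid]
  funext x
  have h0 := xi_one_apply_even 0 x
  have h1 := xi_one_apply_odd 0 x
  norm_num at h0 h1
  by_cases hx : x ∈ Set.Icc (0 : ℝ) 1
  · simp only [restrict, Pi.add_apply, Pi.smul_apply, Set.indicator_of_mem hx, h0, h1, halfSpline,
      smul_eq_mul]
    ring
  · simp [restrict, Set.indicator_of_notMem hx]

theorem exists_of_mem_spaceB1 {f : ℝ → ℝ} (hf : f ∈ spaceB1) :
    ∃ y₁ y₂ s t, f = restrict (halfSpline 0 0 s t y₁ y₂) := by
  rw [spaceB1, Submodule.span_union, Submodule.span_eq, Submodule.mem_sup] at hf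
  obtain ⟨y, hy, z, hz, rfl⟩ := hf
  obtain ⟨a, b, rfl⟩ := Submodule.mem_span_pair.1 hy
  obtain ⟨s, t, rfl⟩ := mem_spaceA0_iff.1 hz
  refine ⟨a * Real.sqrt 2, b * Real.sqrt 2, s, t, ?_⟩
  rw [← restrict_halfSpline_mid]
  funext x
  have h0 := xi_one_apply_even 2 x
  have h1 := xi_one_apply_odd 2 x
  norm_num at h0 h1
  by_cases hx : x ∈ Set.Icc (0 : ℝ) 1
  · simp only [restrict, Pi.add_apply, Pi.smul_apply, Set.indicator_of_mem hx, h0, h1, halfSpline,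
      smul_eq_mul]
    ring
  · simp [restrict, Set.indicator_of_notMem hx]

theorem nodal_mem_spaceA1 (v₁ v₂ v₃ d₁ d₂ d₃ : ℝ) :
    nodal ![0, v₁, v₂, v₃, 0] ![0, d₁, d₂, d₃, 0] ∈ spaceA1 := by
  have h : nodal ![0, v₁, v₂, v₃, 0] ![0, d₁, d₂, d₃, 0] = (v₁ / 2) • xi 2 2 + (d₁ / 2) • xi 2 3 +
      (v₂ / 2) • xi 2 4 + (d₂ / 2) • xi 2 5 + (v₃ / 2) • xi 2 6 + (d₃ / 2) • xi 2 7 := by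
    funext x
    have h2 := xi_two_apply_even 1 x
    have h3 := xi_two_apply_odd 1 x
    have h4 := xi_two_apply_even 2 x
    have h5 := xi_two_apply_odd 2 x
    have h6 := xi_two_apply_even 3 x
    have h7 := xi_two_apply_odd 3 x
    norm_num at h2 h3 h4 h5 h6 h7
    simp only [Pi.add_apply, Pi.smul_apply, smul_eq_mul, h2, h3, h4, h5, h6, h7, nodal]
    simp [Fin.sum_univ_five]
    ring
  have hm : ∀ (c : ℝ) (n : ℤ), 2 ≤ n → n ≤ 7 → c • xi 2 n ∈ spaceA1 := fun c n h1 h2 =>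
    Submodule.smul_mem _ _ (Submodule.subset_span ⟨n, ⟨h1, h2⟩, rfl⟩)
  rw [h]
  exact add_mem (add_mem (add_mem (add_mem (add_mem (hm _ _ (by norm_num) (by norm_num))
    (hm _ _ (by norm_num) (by norm_num))) (hm _ _ (by norm_num) (by norm_num)))
    (hm _ _ (by norm_num) (by norm_num))) (hm _ _ (by norm_num) (by norm_num)))
    (hm _ _ (by norm_num) (by norm_num))

theorem spaceA1_le : spaceA1 ≤ c1Splines ⊓ supportedIn 0 1 := by
  refine Submodule.span_le.2 ?_
  rintro _ ⟨n, ⟨h1, h2⟩, rfl⟩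
  refine ⟨xi_mem_c1Splines 2 n, xi_supportedIn 2 n ?_ ?_⟩
  · have : (1 : ℤ) ≤ n / 2 := by omega
    have : (1 : ℝ) ≤ ((n / 2 : ℤ) : ℝ) := by exact_mod_cast this
    linarith
  · have : n / 2 ≤ (3 : ℤ) := by omega
    have : ((n / 2 : ℤ) : ℝ) ≤ 3 := by exact_mod_cast this
    norm_num
    linarith

theorem memLp_of_mem_spaceA1 {f : ℝ → ℝ} (hf : f ∈ spaceA1) : MemLp f 2 volume :=
  memLp_of_c1Splines (spaceA1_le hf).1 (spaceA1_le hf).2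

theorem restrict_eq_self {f : ℝ → ℝ} (hf : f ∈ supportedIn 0 1) : restrict f = f :=
  Set.indicator_eq_self.2 fun x hx => by
    by_contra h
    refine hx (hf x ?_)
    by_contra! h'
    exact h ⟨h'.1.le, h'.2.le⟩

theorem memLp_restrict {f : ℝ → ℝ} (hf : MemLp f 2 volume) : MemLp (restrict f) 2 volume :=
  hf.indicator measurableSet_Icc

/-- Splines in `A₁ ⊖ A₀` in the coordinates dual to the orthogonal projections of `ξ₁(2x)`,
`ξ₂(2x)`, `ξ₁(2x - 2)`, `-ξ₂(2x - 2)` to the complement of `A₀`. -/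
def dualSpline (a b y z : ℝ) : ℝ → ℝ :=
  nodal
    ![0, -3799 / 132 * a + 8485 / 44 * b + 1151 / 132 * y - 2405 / 44 * z,
      794 / 33 * a - 1520 / 11 * b + 794 / 33 * y - 1520 / 11 * z,
      1151 / 132 * a - 2405 / 44 * b - 3799 / 132 * y + 8485 / 44 * z, 0]
    ![0, -13727 / 44 * a + 68725 / 44 * b + 2003 / 44 * y - 12565 / 44 * z,
      -325 * a + 1985 * b + 325 * y - 1985 * z,
      -2003 / 44 * a + 12565 / 44 * b + 13727 / 44 * y - 68725 / 44 * z, 0]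

theorem dualSpline_mem (a b y z : ℝ) : dualSpline a b y z ∈ spaceA1 := by
  exact nodal_mem_spaceA1 _ _ _ _ _ _

theorem restrict_dualSpline (a b y z : ℝ) : restrict (dualSpline a b y z) = dualSpline a b y z :=
  restrict_eq_self (spaceA1_le (dualSpline_mem a b y z)).2

/-- The absence of `s` and `t` on the right says that the dual splines are orthogonal to `A₀`. The
sign of `y₂ * z` reflects the symmetry `x ↦ 1 - x`, which changes the sign of `ξ₂`. -/
theorem ip_halfSpline_dualSpline (x₁ x₂ s t y₁ y₂ a b y z : ℝ) :
    ip (restrict (halfSpline x₁ x₂ s t y₁ y₂)) (dualSpline a b y z) =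
      x₁ * a + x₂ * b + y₁ * y - y₂ * z := by
  rw [← restrict_dualSpline, restrict_halfSpline, dualSpline, ip_restrict_nodal]
  simp [Fin.sum_univ_four, elementForm]
  ring

theorem ip_dualSpline_one_one (y z : ℝ) :
    ip (dualSpline 1 0 y z) (dualSpline 1 0 y z) = gram11 y z := by
  rw [← restrict_dualSpline, dualSpline, ip_restrict_nodal]
  simp [Fin.sum_univ_four, elementForm, gram11]
  ring

theorem ip_dualSpline_one_two (y y' z z' : ℝ) :
    ip (dualSpline 1 0 y z) (dualSpline 0 1 y' z') = gram12 y y' z z' := by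
  rw [← restrict_dualSpline 1, ← restrict_dualSpline 0, dualSpline, dualSpline, ip_restrict_nodal]
  simp [Fin.sum_univ_four, elementForm, gram12]
  ring

theorem ip_dualSpline_two_two (y z : ℝ) :
    ip (dualSpline 0 1 y z) (dualSpline 0 1 y z) = gram22 y z := by
  rw [← restrict_dualSpline, dualSpline, ip_restrict_nodal]
  simp [Fin.sum_univ_four, elementForm, gram22]
  ring

theorem ip_halfSpline_mid_left (x₁ x₂ s t s' t' : ℝ) :
    ip (restrict (halfSpline x₁ x₂ s t 0 0)) (halfSpline 0 0 s' t' 0 0) =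
      (9 / 140 * x₁ + 13 / 840 * x₂ + 13 / 35 * s) * s' +
      (-13 / 840 * x₁ - 1 / 280 * x₂ + 1 / 105 * t) * t' := by
  rw [← restrict_halfSpline_mid, restrict_halfSpline, restrict_halfSpline, ip_restrict_nodal]
  simp [Fin.sum_univ_four, elementForm]
  ring

theorem ip_halfSpline_mid_right (y₁ y₂ s t s' t' : ℝ) :
    ip (restrict (halfSpline 0 0 s t y₁ y₂)) (halfSpline 0 0 s' t' 0 0) =
      (9 / 140 * y₁ - 13 / 840 * y₂ + 13 / 35 * s) * s' +
      (13 / 840 * y₁ - 1 / 280 * y₂ + 1 / 105 * t) * t' := by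
  rw [← restrict_halfSpline_mid, restrict_halfSpline, restrict_halfSpline, ip_restrict_nodal]
  simp [Fin.sum_univ_four, elementForm]
  ring

theorem ip_halfSpline_left_right (x₁ x₂ s t s' t' y₁ y₂ : ℝ) :
    ip (restrict (halfSpline x₁ x₂ s t 0 0)) (restrict (halfSpline 0 0 s' t' y₁ y₂)) =
      (9 / 140 * x₁ + 13 / 840 * x₂) * s' + (-13 / 840 * x₁ - 1 / 280 * x₂) * t' +
      (9 / 140 * y₁ - 13 / 840 * y₂) * s + (13 / 840 * y₁ - 1 / 280 * y₂) * t +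
      13 / 35 * s * s' + 1 / 105 * t * t' := by
  rw [restrict_halfSpline, restrict_halfSpline, ip_restrict_nodal]
  simp [Fin.sum_univ_four, elementForm]
  ring

/-- The inner product of elements of `C₀` and `C₁` in coordinates. -/
theorem ip_spaceC0_spaceC1 {x₁ x₂ s t s' t' y₁ y₂ : ℝ}
    (hu : restrict (halfSpline x₁ x₂ s t 0 0) ∈ spaceC0)
    (hv : restrict (halfSpline 0 0 s' t' y₁ y₂) ∈ spaceC1) :
    ip (restrict (halfSpline x₁ x₂ s t 0 0)) (restrict (halfSpline 0 0 s' t' y₁ y₂)) =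
      35 / 2496 * x₁ * y₁ - 1 / 320 * x₁ * y₂ + 1 / 320 * x₂ * y₁ - 1 / 1440 * x₂ * y₂ := by
  have h1 := hu.2 _ (mem_spaceA0_iff.2 ⟨1, 0, rfl⟩)
  have h2 := hu.2 _ (mem_spaceA0_iff.2 ⟨0, 1, rfl⟩)
  have h3 := hv.2 _ (mem_spaceA0_iff.2 ⟨1, 0, rfl⟩)
  have h4 := hv.2 _ (mem_spaceA0_iff.2 ⟨0, 1, rfl⟩)
  rw [ip_halfSpline_mid_left] at h1 h2
  rw [ip_halfSpline_mid_right] at h3 h4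
  -- Orthogonality to `A₀` determines the middle coefficients from the boundary ones. The equations
  -- for value and slope decouple because the two functions spanning `A₀` are even and odd about
  -- `1/2`.
  obtain rfl : s = -(35 / 13) * (9 / 140 * x₁ + 13 / 840 * x₂) := by linarith
  obtain rfl : t = -105 * (-13 / 840 * x₁ - 1 / 280 * x₂) := by linarith
  obtain rfl : s' = -(35 / 13) * (9 / 140 * y₁ - 13 / 840 * y₂) := by linarith
  obtain rfl : t' = -105 * (13 / 840 * y₁ - 1 / 280 * y₂) := by linarith
  rw [ip_halfSpline_left_right]
  ring

/-! ### Existence of admissible pairs -/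

theorem halfSpline_mem_c1Splines (x₁ x₂ s t y₁ y₂ : ℝ) :
    halfSpline x₁ x₂ s t y₁ y₂ ∈ c1Splines ⊓ supportedIn (-1) 2 := by
  have key : ∀ (c : ℝ) (f : ℝ → ℝ) (b : ℝ), f ∈ c1Splines → f ∈ supportedIn (-1) 1 → 0 ≤ b → b ≤ 2 →
      (c • fun x => f (2 * x - b)) ∈ c1Splines ⊓ supportedIn (-1) 2 := fun c f b h1 h2 h3 h4 =>
    Submodule.smul_mem _ _ ⟨comp_affine_mem_c1Splines h1 (by norm_num) b, fun x hx => h2 _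
      (hx.imp (fun h => by linarith) fun h => by linarith)⟩
  have h : halfSpline x₁ x₂ s t y₁ y₂ = (x₁ • fun x => hermite1 (2 * x - 0)) +
      (x₂ • fun x => hermite2 (2 * x - 0)) + (s • fun x => hermite1 (2 * x - 1)) +
      (t • fun x => hermite2 (2 * x - 1)) + (y₁ • fun x => hermite1 (2 * x - 2)) +
      (y₂ • fun x => hermite2 (2 * x - 2)) := by
    funext x
    simp [halfSpline]
  rw [h]
  have a1 := hermite1_mem
  have a2 := hermite2_mem
  have b1 := hermite1_supportedIn
  have b2 := hermite2_supportedIn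
  exact add_mem (add_mem (add_mem (add_mem (add_mem (key _ _ _ a1 b1 (by norm_num) (by norm_num))
    (key _ _ _ a2 b2 (by norm_num) (by norm_num))) (key _ _ _ a1 b1 (by norm_num) (by norm_num)))
    (key _ _ _ a2 b2 (by norm_num) (by norm_num))) (key _ _ _ a1 b1 (by norm_num) (by norm_num)))
    (key _ _ _ a2 b2 (by norm_num) (by norm_num))

theorem memLp_halfSpline (x₁ x₂ s t y₁ y₂ : ℝ) : MemLp (halfSpline x₁ x₂ s t y₁ y₂) 2 volume :=
  memLp_of_c1Splines (halfSpline_mem_c1Splines ..).1 (halfSpline_mem_c1Splines ..).2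

theorem ip_self_pos_of_ip_ne_zero {f g : ℝ → ℝ} (hf : Continuous f) {a b : ℝ}
    (hs : f ∈ supportedIn a b) (h : ip g f ≠ 0) : 0 < ip f f := by
  obtain ⟨x, hx⟩ : ∃ x, f x ≠ 0 := by
    by_contra! h'
    exact h (ip_eq_zero_of_mul_eq_zero fun x => by simp [h'])
  exact ip_self_pos hf (hasCompactSupport_of_supportedIn hs) hx

/-- Gram-Schmidt orthonormalization of two functions. -/
theorem exists_orthonormal_pair {w₁ w₂ : ℝ → ℝ} (h₁ : MemLp w₁ 2 volume) (h₂ : MemLp w₂ 2 volume)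
    (hpos : 0 < ip w₁ w₁) (hpos' : ∀ c : ℝ, 0 < ip (w₂ - c • w₁) (w₂ - c • w₁)) :
    ∃ f₃ f₄ : ℝ → ℝ, ip f₃ f₃ = 1 ∧ ip f₄ f₄ = 1 ∧ ip f₃ f₄ = 0 ∧
      Submodule.span ℝ {f₃, f₄} = Submodule.span ℝ {w₁, w₂} := by
  set c := ip w₁ w₂ / ip w₁ w₁ with hc
  have hn : ∀ {f : ℝ → ℝ}, 0 < ip f f → (l2norm f)⁻¹ ≠ 0 := fun hf =>
    inv_ne_zero (Real.sqrt_pos.2 hf).ne'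
  have hc' : MemLp (c • w₁) 2 volume := h₁.const_smul c
  refine ⟨normalize w₁, normalize (w₂ - c • w₁), ip_normalize_self hpos,
    ip_normalize_self (hpos' c), ?_, ?_⟩
  · rw [normalize, normalize, ip_smul_left, ip_smul_right, ip_sub_right h₂ hc' h₁,
      ip_smul_right, hc,
      div_mul_cancel₀ _ hpos.ne', sub_self, mul_zero, mul_zero]
  · have m1 : w₁ ∈ Submodule.span ℝ {w₁, w₂} := Submodule.subset_span (by simp)
    have m2 : w₂ ∈ Submodule.span ℝ {w₁, w₂} := Submodule.subset_span (by simp)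
    have hw₁ : w₁ ∈ Submodule.span ℝ {normalize w₁, normalize (w₂ - c • w₁)} := by
      have : w₁ = ((l2norm w₁)⁻¹)⁻¹ • normalize w₁ := by
        rw [normalize, inv_smul_smul₀ (hn hpos)]
      rw [this]
      exact Submodule.smul_mem _ _ (Submodule.subset_span (by rw [← this]; simp))
    have hw₂ : w₂ - c • w₁ ∈ Submodule.span ℝ {normalize w₁, normalize (w₂ - c • w₁)} := by
      have : w₂ - c • w₁ = ((l2norm (w₂ - c • w₁))⁻¹)⁻¹ • normalize (w₂ - c • w₁) := by
        rw [normalize, inv_smul_smul₀ (hn (hpos' c))]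
      rw [this]
      exact Submodule.smul_mem _ _ (Submodule.subset_span (by rw [← this]; simp))
    apply le_antisymm
    · rw [Submodule.span_le]
      rintro f (rfl | rfl)
      · exact Submodule.smul_mem _ _ m1
      · exact Submodule.smul_mem _ _ (sub_mem m2 (Submodule.smul_mem _ _ m1))
    · rw [Submodule.span_le]
      rintro f (rfl | rfl)
      · exact hw₁
      · have := add_mem hw₂ (Submodule.smul_mem _ c hw₁)
        rwa [sub_add_cancel] at this

/-- For `u` in `C₀` with boundary coordinates `x`, the projection onto `W` has the coefficients `G⁻¹
x`, because the basis is dual to the left boundary functions. The pairing of the projection with an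
element of `C₁` is then read off from `Z`, and the Riccati equation equates it with the pairing of
`u` itself. -/
theorem exists_isAdmissible : ∃ f3 f4 : ℝ → ℝ, IsAdmissible f3 f4 := by
  obtain ⟨z11, z12, z21, z22, e1, e2, e3, e4⟩ := exists_riccati_solution
  set w₁ := dualSpline 1 0 z11 z21 with hw₁
  set w₂ := dualSpline 0 1 z12 z22 with hw₂
  have m₁ : w₁ ∈ spaceA1 := dualSpline_mem _ _ _ _
  have m₂ : w₂ ∈ spaceA1 := dualSpline_mem _ _ _ _
  have l₁ := memLp_of_mem_spaceA1 m₁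
  have l₂ := memLp_of_mem_spaceA1 m₂
  have g11 : ip w₁ w₁ = gram11 z11 z21 := ip_dualSpline_one_one ..
  have g12 : ip w₁ w₂ = gram12 z11 z12 z21 z22 := ip_dualSpline_one_two ..
  have g21 : ip w₂ w₁ = gram12 z11 z12 z21 z22 := by rw [ip_comm, g12]
  have g22 : ip w₂ w₂ = gram22 z12 z22 := ip_dualSpline_two_two ..
  have hpos : 0 < ip w₁ w₁ := by
    refine ip_self_pos_of_ip_ne_zero (g := restrict (halfSpline 1 0 0 0 0 0))
      (spaceA1_le m₁).1.2.continuous (spaceA1_le m₁).2 ?_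
    rw [hw₁, ip_halfSpline_dualSpline]
    norm_num
  -- Duality gives linear independence: the pairing with `ξ₂(2x)` on `[0, 1]` is `1` for `w₂` and
  -- `0` for `w₁`.
  have hpos' : ∀ c : ℝ, 0 < ip (w₂ - c • w₁) (w₂ - c • w₁) := fun c => by
    have m := sub_mem m₂ (Submodule.smul_mem _ c m₁)
    refine ip_self_pos_of_ip_ne_zero (g := restrict (halfSpline 0 1 0 0 0 0))
      (spaceA1_le m).1.2.continuous (spaceA1_le m).2 ?_
    rw [ip_sub_right l₂ (l₁.const_smul c) (memLp_restrict (memLp_halfSpline ..)), ip_smul_right,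
      hw₁, hw₂, ip_halfSpline_dualSpline, ip_halfSpline_dualSpline]
    norm_num
  obtain ⟨f₃, f₄, n3, n4, n34, hspan⟩ := exists_orthonormal_pair l₁ l₂ hpos hpos'
  refine ⟨f₃, f₄, n3, n4, n34, ?_, ?_⟩
  · rw [hspan]
    intro f hf
    obtain ⟨a, b, rfl⟩ := Submodule.mem_span_pair.1 hf
    refine ⟨add_mem (Submodule.smul_mem _ _ m₁) (Submodule.smul_mem _ _ m₂), fun g hg => ?_⟩
    obtain ⟨s, t, rfl⟩ := mem_spaceA0_iff.1 hg
    rw [← restrict_halfSpline_mid, ip_comm, ip_add_right (l₁.const_smul a) (l₂.const_smul b)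
      (memLp_restrict (memLp_halfSpline ..)), ip_smul_right, ip_smul_right, hw₁, hw₂,
      ip_halfSpline_dualSpline, ip_halfSpline_dualSpline]
    ring
  · rw [hspan]
    rintro u hu v hv p q ⟨hp, hp'⟩ ⟨hq, hq'⟩
    obtain ⟨x₁, x₂, s, t, rfl⟩ := exists_of_mem_spaceB0 hu.1
    obtain ⟨y₁, y₂, s', t', rfl⟩ := exists_of_mem_spaceB1 hv.1
    have lu := memLp_restrict (memLp_halfSpline x₁ x₂ s t 0 0)
    have lv := memLp_restrict (memLp_halfSpline 0 0 s' t' y₁ y₂)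
    have huv := ip_spaceC0_spaceC1 hu hv
    obtain ⟨a, b, rfl⟩ := Submodule.mem_span_pair.1 hp
    have lp : MemLp (a • w₁ + b • w₂) 2 volume := (l₁.const_smul a).add (l₂.const_smul b)
    have lq : MemLp q 2 volume := by
      obtain ⟨c, d, rfl⟩ := Submodule.mem_span_pair.1 hq
      exact (l₁.const_smul c).add (l₂.const_smul d)
    have k1 := hp' w₁ (Submodule.subset_span (by simp))
    have k2 := hp' w₂ (Submodule.subset_span (by simp))
    rw [ip_sub_left lu lp l₁, ip_add_left (l₁.const_smul a) (l₂.const_smul b) l₁, ip_smul_left,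
      ip_smul_left, g11, g21, hw₁, ip_halfSpline_dualSpline] at k1
    rw [ip_sub_left lu lp l₂, ip_add_left (l₁.const_smul a) (l₂.const_smul b) l₂, ip_smul_left,
      ip_smul_left, g12, g22, hw₂, ip_halfSpline_dualSpline] at k2
    -- Since `u - p` is orthogonal to `q`, only the difference of the pairings of `u` and `p` with
    -- `v` remains.
    rw [ip_sub_right lv lq (lu.sub lp), hp' q hq, ip_sub_left lu lp lv,
      ip_add_left (l₁.const_smul a) (l₂.const_smul b) lv, ip_smul_left, ip_smul_left, huv,
      ip_comm w₁, ip_comm w₂, hw₁, hw₂, ip_halfSpline_dualSpline, ip_halfSpline_dualSpline]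
    -- The normal equations are solved for `x₁, x₂` instead of `a, b`, so the Gram matrix need not
    -- be inverted. The multipliers of the Riccati equations below are then products of `a`, `b`
    -- with the entries of `M` applied to `(y₁, -y₂)`.
    obtain rfl : x₁ = a * gram11 z11 z21 + b * gram12 z11 z12 z21 z22 := by linarith
    obtain rfl : x₂ = a * gram12 z11 z12 z21 z22 + b * gram22 z12 z22 := by linarith
    linear_combination -(a * (35 / 2496 * y₁ - 1 / 320 * y₂)) * e1 -
      b * (35 / 2496 * y₁ - 1 / 320 * y₂) * e2 - a * (1 / 320 * y₁ - 1 / 1440 * y₂) * e3 -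
      b * (1 / 320 * y₁ - 1 / 1440 * y₂) * e4

/-! ### Closed spans -/

theorem subset_closedSpan {ι : Type*} {F : ι → ℝ → ℝ} {g : L2R} {i : ι} (h : ⇑g =ᵐ[volume] F i) :
    g ∈ closedSpan F :=
  Submodule.le_topologicalClosure _ (Submodule.subset_span ⟨i, h⟩)

/-- Algebraic identities between genuine functions are transferred to `L²` classes here; inclusions
of spaces reduce to finite linear combinations. -/
theorem mem_closedSpan {ι : Type*} {F : ι → ℝ → ℝ} (hF : ∀ i, MemLp (F i) 2 volume) {f : ℝ → ℝ}
    (hf : f ∈ Submodule.span ℝ (Set.range F)) {g : L2R} (hg : ⇑g =ᵐ[volume] f) :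
    g ∈ closedSpan F := by
  obtain ⟨h, hh, hfh⟩ : ∃ h ∈ closedSpan F, ⇑h =ᵐ[volume] f := by
    clear hg
    induction hf using Submodule.span_induction with
    | mem x hx =>
      obtain ⟨i, rfl⟩ := hx
      exact ⟨(hF i).toLp _, subset_closedSpan (hF i).coeFn_toLp, (hF i).coeFn_toLp⟩
    | zero => exact ⟨0, zero_mem _, Lp.coeFn_zero _ _ _⟩
    | add x y _ _ hx hy =>
      obtain ⟨a, ha, ha'⟩ := hx
      obtain ⟨b, hb, hb'⟩ := hy
      exact ⟨a + b, add_mem ha hb, (Lp.coeFn_add a b).trans (ha'.add hb')⟩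
    | smul c x _ hx =>
      obtain ⟨a, ha, ha'⟩ := hx
      exact ⟨c • a, Submodule.smul_mem _ c ha, (Lp.coeFn_smul c a).trans (ha'.const_smul c)⟩
  rwa [Lp.ext (hg.trans hfh.symm)]

theorem closedSpan_le_of_isClosed {ι : Type*} {F : ι → ℝ → ℝ} {V : Submodule ℝ L2R}
    (hV : IsClosed (V : Set L2R)) (h : ∀ (i : ι) (g : L2R), ⇑g =ᵐ[volume] F i → g ∈ V) :
    closedSpan F ≤ V :=
  Submodule.topologicalClosure_minimal _ (Submodule.span_le.2 fun g ⟨i, hi⟩ => h i g hi) hV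

theorem isClosed_closedSpan {ι : Type*} (F : ι → ℝ → ℝ) : IsClosed (closedSpan F : Set L2R) :=
  Submodule.isClosed_topologicalClosure _

theorem closedSpan_le_closedSpan {ι κ : Type*} {F : ι → ℝ → ℝ} {G : κ → ℝ → ℝ}
    (hG : ∀ i, MemLp (G i) 2 volume) (h : ∀ i, F i ∈ Submodule.span ℝ (Set.range G)) :
    closedSpan F ≤ closedSpan G :=
  closedSpan_le_of_isClosed (isClosed_closedSpan G) fun i _ hg => mem_closedSpan hG (h i) hg

/-! ### Dilations -/

/-- The dilation `2 ^ (k / 2) f(2 ^ k x)`. -/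
def dilFun (k : ℤ) (f : ℝ → ℝ) (x : ℝ) : ℝ := (2 : ℝ) ^ ((k : ℝ) / 2) * f ((2 : ℝ) ^ k * x)

theorem two_rpow_half_mul_self (k : ℤ) :
    (2 : ℝ) ^ ((k : ℝ) / 2) * (2 : ℝ) ^ ((k : ℝ) / 2) = (2 : ℝ) ^ k := by
  rw [← Real.rpow_add two_pos, add_halves, Real.rpow_intCast]

theorem dilFun_add (j k : ℤ) (f : ℝ → ℝ) : dilFun (j + k) f = dilFun k (dilFun j f) := by
  funext x
  simp only [dilFun]
  rw [zpow_add₀ two_ne_zero, mul_assoc, ← mul_assoc ((2 : ℝ) ^ ((k : ℝ) / 2)),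
    ← Real.rpow_add two_pos]
  push_cast
  congr 2
  ring

theorem dilFun_zero (f : ℝ → ℝ) : dilFun 0 f = f := by
  funext x
  simp [dilFun]

theorem quasiMeasurePreserving_mul_left {a : ℝ} (ha : a ≠ 0) :
    Measure.QuasiMeasurePreserving (fun x : ℝ => a * x) volume volume :=
  ⟨measurable_const_mul a, by
    rw [Real.map_volume_mul_left ha]
    exact Measure.smul_absolutelyContinuous⟩

theorem dilFun_congr_ae (k : ℤ) {f g : ℝ → ℝ} (h : f =ᵐ[volume] g) :
    dilFun k f =ᵐ[volume] dilFun k g := by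
  have := (quasiMeasurePreserving_mul_left (a := (2 : ℝ) ^ k) (by positivity)).ae_eq_comp h
  filter_upwards [this] with x hx
  simp only [Function.comp_apply] at hx
  simp only [dilFun, hx]

theorem memLp_dilFun (k : ℤ) {f : ℝ → ℝ} (hf : MemLp f 2 volume) :
    MemLp (dilFun k f) 2 volume := by
  have hk : (2 : ℝ) ^ k ≠ 0 := by positivity
  have hm : AEStronglyMeasurable (fun x => f ((2 : ℝ) ^ k * x)) volume :=
    hf.1.comp_quasiMeasurePreserving (quasiMeasurePreserving_mul_left hk)
  refine MemLp.const_mul ?_ _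
  rw [memLp_two_iff_integrable_sq hm, integrable_comp_mul_left_iff (fun x => f x ^ 2) hk]
  exact (memLp_two_iff_integrable_sq hf.1).1 hf

theorem ip_dilFun (k : ℤ) (f g : ℝ → ℝ) : ip (dilFun k f) (dilFun k g) = ip f g := by
  have hk : (0 : ℝ) < (2 : ℝ) ^ k := by positivity
  have h : ip (dilFun k f) (dilFun k g) =
      ∫ x, (2 : ℝ) ^ k * (fun y => f y * g y) ((2 : ℝ) ^ k * x) := by
    refine integral_congr_ae (Filter.Eventually.of_forall fun x => ?_)
    simp only [dilFun]
    rw [← two_rpow_half_mul_self]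
    ring
  rw [h, integral_const_mul,
    Measure.integral_comp_mul_left (fun y => f y * g y) ((2 : ℝ) ^ k),
    abs_of_pos (inv_pos.2 hk), smul_eq_mul,
    mul_inv_cancel_left₀ hk.ne', ip]

theorem norm_sq_eq_ip (f : L2R) : ‖f‖ ^ 2 = ip f f := by
  rw [← inner_eq_ip, real_inner_self_eq_norm_sq]

/-- The dilation operator on `L²(ℝ)`. -/
def dil (k : ℤ) : L2R →ₗᵢ[ℝ] L2R where
  toFun f := (memLp_dilFun k (Lp.memLp f)).toLp _
  map_add' f g := by
    rw [← MemLp.toLp_add, MemLp.toLp_eq_toLp_iff]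
    refine (dilFun_congr_ae k (Lp.coeFn_add f g)).trans (Filter.Eventually.of_forall fun x => ?_)
    simp [dilFun, mul_add]
  map_smul' c f := by
    rw [RingHom.id_apply, ← MemLp.toLp_const_smul, MemLp.toLp_eq_toLp_iff]
    refine (dilFun_congr_ae k (Lp.coeFn_smul c f)).trans (Filter.Eventually.of_forall fun x => ?_)
    simp [dilFun, mul_left_comm]
  norm_map' f := by
    refine (sq_eq_sq₀ (norm_nonneg _) (norm_nonneg _)).1 ?_
    rw [norm_sq_eq_ip, norm_sq_eq_ip, ← ip_dilFun k f f]
    have h := (memLp_dilFun k (Lp.memLp f)).coeFn_toLp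
    exact ip_congr_ae h h

theorem coeFn_dil (k : ℤ) (f : L2R) : ⇑(dil k f) =ᵐ[volume] dilFun k f :=
  (memLp_dilFun k (Lp.memLp f)).coeFn_toLp

theorem dil_dil (j k : ℤ) (f : L2R) : dil k (dil j f) = dil (j + k) f := by
  refine Lp.ext ((coeFn_dil k _).trans ?_)
  refine (dilFun_congr_ae k (coeFn_dil j f)).trans ?_
  rw [← dilFun_add]
  exact (coeFn_dil _ f).symm

theorem dil_zero (f : L2R) : dil 0 f = f := by
  refine Lp.ext ((coeFn_dil 0 _).trans ?_)
  rw [dilFun_zero]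

theorem dil_dil_neg (k : ℤ) (f : L2R) : dil k (dil (-k) f) = f := by
  rw [dil_dil, neg_add_cancel, dil_zero]

theorem dil_mem_closedSpan (k : ℤ) {ι : Type*} {F G : ι → ℝ → ℝ} (h : ∀ i, G i = dilFun k (F i))
    {f : L2R} (hf : f ∈ closedSpan F) : dil k f ∈ closedSpan G := by
  have : closedSpan F ≤ (closedSpan G).comap (dil k).toLinearMap := by
    refine closedSpan_le_of_isClosed ((isClosed_closedSpan G).preimage (dil k).continuous) ?_
    intro i g hg
    refine subset_closedSpan (i := i) ?_
    rw [h i]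
    exact (coeFn_dil k g).trans (dilFun_congr_ae k hg)
  exact this hf

theorem xi_add (j k n : ℤ) : xi (j + k) n = dilFun k (xi j n) := by
  have h : ∀ j, xi j n = dilFun j fun x =>
      (if n % 2 = 0 then hermite1 else hermite2) (x - ((n / 2 : ℤ) : ℝ)) := fun j => rfl
  rw [h, h, dilFun_add]

theorem scalingFun_eq_dilFun (φ : Fin 6 → ℝ → ℝ) (j n : ℤ) : scalingFun φ j n = dilFun j fun x =>
    φ (Fin.ofNat 6 ((n - 1) % 6).toNat)
      (x - (((n - 1) / 6 : ℤ) : ℝ) - (if (n - 1) % 6 < 4 then 0 else 1)) := rfl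

theorem scalingFun_add (φ : Fin 6 → ℝ → ℝ) (j k n : ℤ) :
    scalingFun φ (j + k) n = dilFun k (scalingFun φ j n) := by
  rw [scalingFun_eq_dilFun, scalingFun_eq_dilFun, dilFun_add]

theorem dil_mem_hermiteSpace {j : ℤ} (k : ℤ) {f : L2R} (hf : f ∈ hermiteSpace j) :
    dil k f ∈ hermiteSpace (j + k) :=
  dil_mem_closedSpan k (fun n => xi_add j k n) hf

theorem dil_mem_scalingSpace {φ : Fin 6 → ℝ → ℝ} {j : ℤ} (k : ℤ) {f : L2R}
    (hf : f ∈ scalingSpace φ j) : dil k f ∈ scalingSpace φ (j + k) :=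
  dil_mem_closedSpan k (fun n => scalingFun_add φ j k n) hf

theorem hermiteSpace_add_le {φ : Fin 6 → ℝ → ℝ} {i j : ℤ} (k : ℤ)
    (h : hermiteSpace i ≤ scalingSpace φ j) : hermiteSpace (i + k) ≤ scalingSpace φ (j + k) := by
  intro f hf
  rw [← dil_dil_neg k f]
  refine dil_mem_scalingSpace k (h ?_)
  have := dil_mem_hermiteSpace (-k) hf
  rwa [add_neg_cancel_right] at this

theorem scalingSpace_add_le {φ : Fin 6 → ℝ → ℝ} {i j : ℤ} (k : ℤ)
    (h : scalingSpace φ j ≤ hermiteSpace i) : scalingSpace φ (j + k) ≤ hermiteSpace (i + k) := by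
  intro f hf
  rw [← dil_dil_neg k f]
  refine dil_mem_hermiteSpace k (h ?_)
  have := dil_mem_scalingSpace (-k) hf
  rwa [add_neg_cancel_right] at this

theorem mem_scalingSpace_iff (φ : Fin 6 → ℝ → ℝ) (j : ℤ) (f : L2R) :
    f ∈ scalingSpace φ j ↔
      ∃ g ∈ scalingSpace φ 0, ⇑g =ᵐ[volume] fun x => f ((2 : ℝ) ^ (-j) * x) := by
  -- The dilation in the statement is not unitary; it differs from `dil (-j)` by the factor `c`,
  -- which a subspace does not see.
  set c : ℝ := (2 : ℝ) ^ (((-j : ℤ) : ℝ) / 2) with hc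
  have hc0 : c ≠ 0 := by positivity
  have key : ⇑(c⁻¹ • dil (-j) f) =ᵐ[volume] fun x => f ((2 : ℝ) ^ (-j) * x) := by
    filter_upwards [Lp.coeFn_smul c⁻¹ (dil (-j) f), coeFn_dil (-j) f] with x h1 h2
    rw [h1, Pi.smul_apply, h2, dilFun, smul_eq_mul, ← hc, inv_mul_cancel_left₀ hc0]
  constructor
  · intro hf
    have := dil_mem_scalingSpace (-j) hf
    rw [add_neg_cancel] at this
    exact ⟨_, Submodule.smul_mem _ _ this, key⟩
  · rintro ⟨g, hg, hgf⟩
    have h1 : dil (-j) f = c • g := by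
      rw [Lp.ext (hgf.trans key.symm), smul_inv_smul₀ hc0]
    rw [← dil_dil_neg j f, h1]
    have := dil_mem_scalingSpace j (Submodule.smul_mem _ c hg)
    rwa [zero_add] at this

/-! ### Density of the spline spaces -/

theorem eq_zero_of_forall_integral_eq_zero {f : L2R}
    (h : ∀ g : ℝ → ℝ, Continuous g → HasCompactSupport g → ∫ x, g x * f x = 0) : f = 0 := by
  refine Lp.ext ?_
  have h1 := ae_eq_zero_of_integral_contDiff_smul_eq_zero
    ((Lp.memLp f).locallyIntegrable (by norm_num)) fun g hg hc => h g hg.continuous hc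
  exact (show ⇑f =ᵐ[volume] 0 from h1).trans (Lp.coeFn_zero _ _ _).symm

theorem hermite1_add_hermite1_sub_one {x : ℝ} (h : 0 ≤ x) (h' : x ≤ 1) :
    hermite1 x + hermite1 (x - 1) = 1 := by
  rw [hermite1_right h h', hermite1_left (by linarith) (by linarith)]
  ring

theorem hermite1_mem_Icc {x : ℝ} (h : 0 ≤ x) (h' : x ≤ 1) : 0 ≤ hermite1 x ∧ hermite1 x ≤ 1 := by
  rw [hermite1_right h h']
  refine ⟨mul_nonneg (sq_nonneg _) (by linarith), ?_⟩
  nlinarith [mul_nonneg (mul_nonneg h h) (by linarith : (0 : ℝ) ≤ 3 - 2 * x)]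

/-- The quasi-interpolant of `g` by Hermite splines with mesh size `1 / a`. -/
def quasiInterp (g : ℝ → ℝ) (a : ℝ) (N : ℤ) (x : ℝ) : ℝ :=
  ∑ k ∈ Finset.Icc (-N) N, g (k / a) * hermite1 (a * x - k)

/-- At each point only the two neighbouring nodes contribute, and by the partition of unity their
weights add up to one. Nodes beyond `N` carry the value zero, so the truncation of the sum loses
nothing. -/
theorem quasiInterp_eq {g : ℝ → ℝ} {a R : ℝ} {N : ℤ} (ha : 0 < a)
    (hg : ∀ x, R < |x| → g x = 0) (hN : a * R ≤ N) (x : ℝ) :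
    quasiInterp g a N x = g ((⌊a * x⌋ : ℤ) / a) * hermite1 (Int.fract (a * x)) +
      g (((⌊a * x⌋ : ℤ) + 1) / a) * (1 - hermite1 (Int.fract (a * x))) := by
  set m := ⌊a * x⌋ with hm
  have hfr : Int.fract (a * x) = a * x - m := rfl
  have hf0 := Int.fract_nonneg (a * x)
  have hf1 := (Int.fract_lt_one (a * x)).le
  have hne : m ≠ m + 1 := by omega
  have h1 : quasiInterp g a N x = ∑ k ∈ Finset.Icc (-N) N ∪ {m, m + 1},
      g (k / a) * hermite1 (a * x - k) := by
    refine Finset.sum_subset Finset.subset_union_left fun k _ hk => ?_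
    rw [hg, zero_mul]
    rw [abs_div, abs_of_pos ha, lt_div_iff₀ ha, mul_comm]
    refine hN.trans_lt ?_
    rw [Finset.mem_Icc, ← abs_le, not_le] at hk
    exact_mod_cast hk
  have h2 : ∑ k ∈ Finset.Icc (-N) N ∪ {m, m + 1}, g (k / a) * hermite1 (a * x - k) =
      ∑ k ∈ ({m, m + 1} : Finset ℤ), g (k / a) * hermite1 (a * x - k) := by
    refine (Finset.sum_subset Finset.subset_union_right fun k _ hk => ?_).symm
    rw [Finset.mem_insert, Finset.mem_singleton, not_or] at hk
    rcases lt_or_ge k m with h | h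
    · have : (k : ℝ) + 1 ≤ m := by exact_mod_cast h
      rw [hermite1_ge (by linarith), mul_zero]
    · have : (m : ℝ) + 2 ≤ k := by exact_mod_cast (by omega : m + 2 ≤ k)
      rw [hermite1_le (by linarith), mul_zero]
  have h3 := hermite1_add_hermite1_sub_one hf0 hf1
  have h4 : a * x - ((m + 1 : ℤ) : ℝ) = Int.fract (a * x) - 1 := by push_cast; linarith
  rw [h1, h2, Finset.sum_pair hne, h4, ← hfr, eq_sub_of_add_eq' h3]
  push_cast
  rfl

/-- A convex combination of two values of `g` is bounded by `C`. As the mesh size is at most one,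
the support grows by at most one; this is the majorant for dominated convergence. -/
theorem abs_quasiInterp_le {g : ℝ → ℝ} {a R C : ℝ} {N : ℤ} (ha : 1 ≤ a)
    (hg : ∀ x, R < |x| → g x = 0) (hN : a * R ≤ N) (hC : ∀ x, |g x| ≤ C) (x : ℝ) :
    |quasiInterp g a N x| ≤ (Set.Icc (-(R + 1)) (R + 1)).indicator (fun _ => C) x := by
  have ha0 : 0 < a := by linarith
  rw [quasiInterp_eq ha0 hg hN]
  obtain ⟨h0, h1⟩ := hermite1_mem_Icc (Int.fract_nonneg (a * x)) (Int.fract_lt_one (a * x)).le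
  by_cases hx : x ∈ Set.Icc (-(R + 1)) (R + 1)
  · rw [Set.indicator_of_mem hx]
    refine (abs_add_le _ _).trans ?_
    rw [abs_mul, abs_mul, abs_of_nonneg h0, abs_of_nonneg (sub_nonneg.2 h1)]
    nlinarith [hC ((⌊a * x⌋ : ℤ) / a), hC (((⌊a * x⌋ : ℤ) + 1) / a)]
  · rw [Set.indicator_of_notMem hx]
    have hx' : R + 1 < |x| := by
      rw [Set.mem_Icc, ← abs_le, not_le] at hx
      exact hx
    have l1 := Int.floor_le (a * x)
    have l2 := (Int.lt_floor_add_one (a * x)).le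
    have hinv : 1 / a ≤ 1 := by rw [div_le_one ha0]; exact ha
    have b1 : (⌊a * x⌋ : ℝ) / a ≤ x := by rw [div_le_iff₀ ha0]; linarith
    have b2 : x ≤ ((⌊a * x⌋ : ℝ) + 1) / a := by rw [le_div_iff₀ ha0]; linarith
    have b3 : ((⌊a * x⌋ : ℝ) + 1) / a = (⌊a * x⌋ : ℝ) / a + 1 / a := by ring
    have c1 : R < |(⌊a * x⌋ : ℝ) / a| := by
      rcases abs_cases x with h | h <;> rcases abs_cases ((⌊a * x⌋ : ℝ) / a) with h' | h' <;>
        linarith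
    have c2 : R < |((⌊a * x⌋ : ℝ) + 1) / a| := by
      rcases abs_cases x with h | h <;> rcases abs_cases (((⌊a * x⌋ : ℝ) + 1) / a) with h' | h' <;>
        linarith
    rw [hg _ c1, hg _ c2]
    simp

theorem tendsto_quasiInterp {g : ℝ → ℝ} {R : ℝ} (hc : Continuous g) (hg : ∀ x, R < |x| → g x = 0)
    {a : ℕ → ℝ} (ha : ∀ j, 1 ≤ a j) (hlim : Filter.Tendsto a Filter.atTop Filter.atTop)
    {N : ℕ → ℤ} (hN : ∀ j, a j * R ≤ N j) (x : ℝ) :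
    Filter.Tendsto (fun j => quasiInterp g (a j) (N j) x) Filter.atTop (nhds (g x)) := by
  have hinv : Filter.Tendsto (fun j => 1 / a j) Filter.atTop (nhds 0) :=
    hlim.const_div_atTop 1
  have hle : ∀ j, (⌊a j * x⌋ : ℝ) / a j ≤ x := fun j => by
    rw [div_le_iff₀ (by linarith [ha j])]
    linarith [Int.floor_le (a j * x)]
  have hge : ∀ j, x - 1 / a j ≤ (⌊a j * x⌋ : ℝ) / a j := fun j => by
    have h0 : 0 < a j := by linarith [ha j]
    rw [le_div_iff₀ h0, sub_mul, div_mul_cancel₀ _ h0.ne']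
    linarith [Int.lt_floor_add_one (a j * x)]
  have t1 : Filter.Tendsto (fun j => (⌊a j * x⌋ : ℝ) / a j) Filter.atTop (nhds x) := by
    refine tendsto_of_tendsto_of_tendsto_of_le_of_le ?_ tendsto_const_nhds hge hle
    simpa using tendsto_const_nhds (x := x) |>.sub hinv
  have t2 : Filter.Tendsto (fun j => ((⌊a j * x⌋ : ℝ) + 1) / a j) Filter.atTop (nhds x) := by
    have := t1.add hinv
    simp only [add_zero, ← add_div] at this
    exact this
  have g1 := (hc.tendsto x).comp t1
  have g2 := (hc.tendsto x).comp t2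
  have hprod := (g1.sub g2)
  rw [sub_self] at hprod
  -- The weights need not converge as the mesh is refined. They stay bounded while the difference of
  -- the two nodal values tends to zero, so their product does too.
  have hz := hprod.zero_mul_isBoundedUnder_le (g := fun j => hermite1 (Int.fract (a j * x)))
    ⟨1, by
      simp only [Filter.eventually_map, Function.comp_apply, Real.norm_eq_abs]
      refine Filter.Eventually.of_forall fun j => ?_
      obtain ⟨h0, h1⟩ := hermite1_mem_Icc (Int.fract_nonneg (a j * x))
        (Int.fract_lt_one (a j * x)).le
      rw [abs_of_nonneg h0]
      exact h1⟩
  have := hz.add g2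
  rw [zero_add] at this
  refine this.congr fun j => ?_
  rw [quasiInterp_eq (by linarith [ha j]) hg (hN j)]
  simp only [Function.comp_apply]
  ring

/-- The quasi-interpolants of a test function are combinations of the `ξ_{j,2k}`, hence orthogonal
to `f`. They converge pointwise under an integrable majorant, so `f` is orthogonal to every test
function. -/
theorem eq_zero_of_ip_xi_eq_zero {f : L2R} (h : ∀ (j : ℕ) (n : ℤ), ip (xi j n) f = 0) : f = 0 := by
  refine eq_zero_of_forall_integral_eq_zero fun g hg hc => ?_
  obtain ⟨R, hR⟩ : ∃ R : ℝ, ∀ x, R < |x| → g x = 0 := by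
    obtain ⟨R, hR⟩ := hc.isCompact.isBounded.subset_closedBall 0
    refine ⟨R, fun x hx => ?_⟩
    by_contra hne
    have := hR (subset_tsupport g hne)
    rw [mem_closedBall_zero_iff, Real.norm_eq_abs] at this
    linarith
  obtain ⟨C, hC⟩ := hc.exists_bound_of_continuous hg
  set a : ℕ → ℝ := fun j => 2 ^ j with ha
  set N : ℕ → ℤ := fun j => ⌈a j * R⌉ with hN
  have ha1 : ∀ j, 1 ≤ a j := fun j => one_le_pow₀ (by norm_num)
  have hN' : ∀ j, a j * R ≤ N j := fun j => Int.le_ceil _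
  have hzero : ∀ j, ∫ x, quasiInterp g (a j) (N j) x * f x = 0 := fun j => by
    have hterm : ∀ k : ℤ, MemLp (fun x => g (k / a j) * hermite1 (a j * x - k)) 2 volume ∧
        ip (fun x => g (k / a j) * hermite1 (a j * x - k)) f = 0 := fun k => by
      have e : (fun x => g (k / a j) * hermite1 (a j * x - k)) =
          (g (k / a j) * ((2 : ℝ) ^ ((j : ℝ) / 2))⁻¹) • xi j (2 * k) := by
        funext x
        have h0 : (2 : ℝ) ^ ((j : ℝ) / 2) ≠ 0 := by positivity
        simp [xi, ha, mul_assoc, h0]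
      rw [e]
      exact ⟨(memLp_xi _ _).const_smul _, by rw [ip_smul_left, h, mul_zero]⟩
    have e : quasiInterp g (a j) (N j) =
        ∑ k ∈ Finset.Icc (-N j) (N j), fun x => g (k / a j) * hermite1 (a j * x - k) := by
      funext x
      simp [quasiInterp]
    change ip (quasiInterp g (a j) (N j)) f = 0
    rw [e, ip_sum_left _ (fun k _ => (hterm k).1) (Lp.memLp f)]
    exact Finset.sum_eq_zero fun k _ => (hterm k).2
  have hcont : ∀ j, Continuous (quasiInterp g (a j) (N j)) := fun j => by
    refine continuous_finsetSum _ fun k _ => continuous_const.mul ?_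
    exact hermite1_mem.2.continuous.comp (by fun_prop)
  have hbound : Integrable
      (fun x => (Set.Icc (-(R + 1)) (R + 1)).indicator (fun _ => C) x * |f x|) volume :=
    integrable_mul_of_memLp (memLp_indicator_const 2 measurableSet_Icc C
      (Or.inr measure_Icc_lt_top.ne)) (Lp.memLp f).abs
  have hlim := tendsto_integral_of_dominated_convergence (μ := volume)
    (F := fun j x => quasiInterp g (a j) (N j) x * f x) (f := fun x => g x * f x) _
    (fun j => (hcont j).aestronglyMeasurable.mul (Lp.aestronglyMeasurable f)) hbound
    (fun j => Filter.Eventually.of_forall fun x => by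
      rw [norm_mul, Real.norm_eq_abs, Real.norm_eq_abs]
      exact mul_le_mul_of_nonneg_right (abs_quasiInterp_le (ha1 j) hR (hN' j) hC x) (abs_nonneg _))
    (Filter.Eventually.of_forall fun x => (tendsto_quasiInterp hg hR ha1
      (tendsto_pow_atTop_atTop_of_one_lt (by norm_num)) hN' x).mul_const _)
  simp only [hzero] at hlim
  exact (tendsto_nhds_unique hlim tendsto_const_nhds)

theorem exists_coeFn_ae_eq_xi (j n : ℤ) : ∃ g : L2R, ⇑g =ᵐ[volume] xi j n :=
  ⟨(memLp_xi j n).toLp _, (memLp_xi j n).coeFn_toLp⟩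

theorem dense_iUnion {V : ℤ → Submodule ℝ L2R} (hmono : Monotone V)
    (h : ∀ j : ℕ, hermiteSpace j ≤ V j) : Dense (⋃ j, (V j : Set L2R)) := by
  rw [← Submodule.coe_iSup_of_directed V hmono.directed_le,
    Submodule.dense_iff_topologicalClosure_eq_top, Submodule.topologicalClosure_eq_top_iff,
    Submodule.eq_bot_iff]
  intro f hf
  refine eq_zero_of_ip_xi_eq_zero fun j n => ?_
  obtain ⟨g, hg⟩ := exists_coeFn_ae_eq_xi j n
  rw [← ip_congr_ae hg (Filter.EventuallyEq.refl _ _), ← inner_eq_ip]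
  exact (Submodule.mem_orthogonal _ f).1 hf g
    (le_iSup V (j : ℤ) (h j (subset_closedSpan hg)))

/-! ### The intersection of the spaces -/

/-- For a finite combination of the `e i`, Cauchy-Schwarz gives the pointwise bound `|f(x)| ≤ √K
‖f‖`. Pairing it with an integrable `g` turns it into a condition that is closed in `L²` and so
passes to the closed span. -/
theorem abs_inner_le_of_orthonormal {ι : Type*} {e : ι → L2R} (he : Orthonormal ℝ e)
    {φ : ι → ℝ → ℝ} (hφ : ∀ i, ⇑(e i) =ᵐ[volume] φ i) {K : ℝ}
    (hK : ∀ (x : ℝ) (s : Finset ι), ∑ i ∈ s, φ i x ^ 2 ≤ K) {f : L2R}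
    (hf : f ∈ (Submodule.span ℝ (Set.range e)).topologicalClosure) {g : L2R}
    (hg : Integrable g volume) : |inner ℝ f g| ≤ Real.sqrt K * ‖f‖ * ∫ x, |g x| := by
  have hclosed : IsClosed {f : L2R | |inner ℝ f g| ≤ Real.sqrt K * ‖f‖ * ∫ x, |g x|} :=
    isClosed_le (by fun_prop) (by fun_prop)
  refine closure_minimal ?_ hclosed hf
  intro f hf
  obtain ⟨c, rfl⟩ := (Finsupp.mem_span_range_iff_exists_finsupp).1 hf
  set f : L2R := c.sum fun i a => a • e i with hfdef
  have hnorm : ‖f‖ ^ 2 = ∑ i ∈ c.support, c i ^ 2 := by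
    rw [← real_inner_self_eq_norm_sq, hfdef, Finsupp.sum, he.inner_sum]
    simp [sq]
  have hfx : ∀ᵐ x, f x = ∑ i ∈ c.support, c i * φ i x := by
    have h1 : ⇑f =ᵐ[volume] ∑ i ∈ c.support, ⇑(c i • e i) := Lp.coeFn_finsetSum _ _
    have h2 : ∀ᵐ x, ∀ i ∈ c.support, (c i • e i : L2R) x = c i * φ i x := by
      rw [Filter.eventually_all_finset]
      intro i _
      filter_upwards [Lp.coeFn_smul (c i) (e i), hφ i] with x h3 h4
      rw [h3, Pi.smul_apply, h4, smul_eq_mul]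
    filter_upwards [h1, h2] with x h3 h4
    rw [h3, Finset.sum_apply]
    exact Finset.sum_congr rfl h4
  have hbound : ∀ᵐ x, |f x| ≤ Real.sqrt K * ‖f‖ := by
    filter_upwards [hfx] with x hx
    rw [hx]
    refine abs_le_of_sq_le_sq ?_ (by positivity)
    have h0 : 0 ≤ K := le_trans (by simp) (hK 0 ∅)
    rw [mul_pow, Real.sq_sqrt h0, hnorm, mul_comm]
    refine (Finset.sum_mul_sq_le_sq_mul_sq _ _ _).trans ?_
    exact mul_le_mul_of_nonneg_left (hK x _) (Finset.sum_nonneg fun i _ => sq_nonneg _)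
  change |inner ℝ f g| ≤ _
  rw [inner_eq_ip, ip, ← integral_const_mul]
  refine (abs_integral_le_integral_abs).trans ?_
  refine integral_mono_ae (integrable_mul_of_memLp (Lp.memLp f) (Lp.memLp g)).abs
    (hg.abs.const_mul _) ?_
  filter_upwards [hbound] with x hx
  rw [abs_mul]
  exact mul_le_mul_of_nonneg_right hx (abs_nonneg _)

theorem integral_abs_dilFun (m : ℕ) (g : ℝ → ℝ) :
    ∫ x, |dilFun m g x| = ((2 : ℝ) ^ ((m : ℝ) / 2))⁻¹ * ∫ x, |g x| := by
  have hc : (0 : ℝ) < (2 : ℝ) ^ ((m : ℝ) / 2) := by positivity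
  have h2 := two_rpow_half_mul_self m
  rw [Int.cast_natCast] at h2
  have h : ∀ x, |dilFun m g x| =
      (2 : ℝ) ^ ((m : ℝ) / 2) * (fun y => |g y|) ((2 : ℝ) ^ (m : ℤ) * x) :=
    fun x => by
      simp only [dilFun, Int.cast_natCast]
      rw [abs_mul, abs_of_pos hc]
  simp only [h]
  rw [integral_const_mul, Measure.integral_comp_mul_left (fun y => |g y|) ((2 : ℝ) ^ (m : ℤ)), ← h2,
    abs_of_pos (by positivity), smul_eq_mul]
  field_simp

theorem inner_dil (k : ℤ) (f g : L2R) : inner ℝ (dil k f) (dil k g) = inner ℝ f g :=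
  (dil k).inner_map_map f g

/-- An element of `V_{-m}` is carried to `V₀` by the unitary dilation of order `m`, which multiplies
the `L¹` norm of a test function by `2^{-m/2}`. Hence an element of all the spaces is orthogonal to
every test function. -/
theorem iInf_scalingSpace_eq_bot {φ : Fin 6 → ℝ → ℝ} {K : ℝ}
    (h : ∀ f ∈ scalingSpace φ 0, ∀ g : L2R, Integrable g volume →
      |inner ℝ f g| ≤ K * ‖f‖ * ∫ x, |g x|) : ⨅ j, scalingSpace φ j = ⊥ := by
  rw [Submodule.eq_bot_iff]
  intro f hf
  rw [Submodule.mem_iInf] at hf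
  refine eq_zero_of_forall_integral_eq_zero fun g hg hc => ?_
  have hg2 : MemLp g 2 volume := hg.memLp_of_hasCompactSupport hc
  set G : L2R := hg2.toLp g with hG
  have hGg : ⇑G =ᵐ[volume] g := hg2.coeFn_toLp
  have hint : Integrable g volume := hg.integrable_of_hasCompactSupport hc
  have hgoal : ∫ x, g x * f x = inner ℝ f G := by
    rw [inner_eq_ip, ip_comm]
    exact (ip_congr_ae hGg (Filter.EventuallyEq.refl _ _)).symm
  have key : ∀ m : ℕ, |inner ℝ f G| ≤
      K * ‖f‖ * (((2 : ℝ) ^ ((m : ℝ) / 2))⁻¹ * ∫ x, |g x|) := fun m => by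
    have hmem : dil m f ∈ scalingSpace φ 0 := by
      have := dil_mem_scalingSpace (m : ℤ) (hf (-m))
      rwa [neg_add_cancel] at this
    have hd : ⇑(dil m G) =ᵐ[volume] dilFun m g := (coeFn_dil _ _).trans (dilFun_congr_ae _ hGg)
    have hdi : Integrable (dilFun m g) volume :=
      ((integrable_comp_mul_left_iff g (by positivity)).2 hint).const_mul _
    have := h _ hmem (dil m G) (hdi.congr hd.symm)
    rw [inner_dil, LinearIsometry.norm_map] at this
    rw [← integral_abs_dilFun]
    refine this.trans_eq ?_
    congr 1
    refine integral_congr_ae ?_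
    filter_upwards [hd] with x hx
    rw [hx]
  have hlim : Filter.Tendsto (fun m : ℕ => K * ‖f‖ * (((2 : ℝ) ^ ((m : ℝ) / 2))⁻¹ * ∫ x, |g x|))
      Filter.atTop (nhds 0) := by
    have h1 : Filter.Tendsto (fun m : ℕ => ((2 : ℝ) ^ ((m : ℝ) / 2))⁻¹) Filter.atTop (nhds 0) := by
      refine Filter.Tendsto.inv_tendsto_atTop ?_
      have h2 : Filter.Tendsto (fun m : ℕ => (m : ℝ) / 2) Filter.atTop Filter.atTop :=
        tendsto_natCast_atTop_atTop.atTop_div_const two_pos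
      exact (tendsto_rpow_atTop_of_base_gt_one 2 (by norm_num)).comp h2
    simpa using (h1.mul_const (∫ x, |g x|)).const_mul (K * ‖f‖)
  rw [hgoal]
  exact abs_nonpos_iff.1 (ge_of_tendsto' hlim key)

/-! ### Orthogonality relations of the generators -/

theorem supportedIn_mono {a b a' b' : ℝ} (ha : a' ≤ a) (hb : b ≤ b') :
    supportedIn a b ≤ supportedIn a' b' := fun _ hf x hx =>
  hf x (hx.imp (fun h => h.trans ha) fun h => hb.trans h)

/-- The continuously differentiable cubic splines that vanish outside `(a, b)`. -/
def splinesOn (a b : ℝ) : Submodule ℝ (ℝ → ℝ) := c1Splines ⊓ supportedIn a b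

theorem splinesOn_mono {a b a' b' : ℝ} (ha : a' ≤ a) (hb : b ≤ b') :
    splinesOn a b ≤ splinesOn a' b' := inf_le_inf_left _ (supportedIn_mono ha hb)

theorem memLp_of_splinesOn {f : ℝ → ℝ} {a b : ℝ} (hf : f ∈ splinesOn a b) : MemLp f 2 volume :=
  memLp_of_c1Splines hf.1 hf.2

theorem comp_sub_mem_splinesOn {f : ℝ → ℝ} {a b : ℝ} (hf : f ∈ splinesOn a b) (c : ℝ) :
    (fun x => f (x - c)) ∈ splinesOn (a + c) (b + c) := by
  refine ⟨by simpa using comp_affine_mem_c1Splines hf.1 one_pos c, fun x hx => hf.2 _ ?_⟩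
  exact hx.imp (fun h => by linarith) fun h => by linarith

theorem shift_eq (f : ℝ → ℝ) : shift f = fun x => f (x - -1) := by
  funext x
  simp [shift]

theorem shift_mem_splinesOn {f : ℝ → ℝ} {a b : ℝ} (hf : f ∈ splinesOn a b) :
    shift f ∈ splinesOn (a - 1) (b - 1) := by
  rw [shift_eq]
  exact comp_sub_mem_splinesOn hf (-1)

theorem shift_mem_left {f : ℝ → ℝ} (hf : f ∈ splinesOn 0 1) : shift f ∈ splinesOn (-1) 0 := by
  have := shift_mem_splinesOn hf
  norm_num at this
  exact this

theorem ip_shift_shift (f g : ℝ → ℝ) : ip (shift f) (shift g) = ip f g := by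
  rw [shift_eq, shift_eq, ip_comp_sub]

theorem ip_shift_left (f g : ℝ → ℝ) : ip (shift f) g = ip f fun x => g (x - 1) := by
  rw [← ip_shift_shift f]
  congr 1
  funext x
  simp [shift]

theorem ip_eq_zero_of_splinesOn {f g : ℝ → ℝ} {a b c d : ℝ} (hf : f ∈ splinesOn a b)
    (hg : g ∈ splinesOn c d) (h : b ≤ c) : ip f g = 0 :=
  ip_eq_zero_of_mul_eq_zero fun x => by
    rcases le_total x b with hx | hx
    · rw [hg.2 x (.inl (hx.trans h)), mul_zero]
    · rw [hf.2 x (.inr hx), zero_mul]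

theorem ip_restrict_left {f g : ℝ → ℝ} (hg : g ∈ splinesOn 0 1) :
    ip (restrict f) g = ip f g := by
  refine integral_congr_ae (Filter.Eventually.of_forall fun x => ?_)
  by_cases hx : x ∈ Set.Icc (0 : ℝ) 1
  · simp [restrict, Set.indicator_of_mem hx]
  · have : g x = 0 := hg.2 x (by
      by_contra! h
      exact hx ⟨h.1.le, h.2.le⟩)
    simp [this]

/-! ### Residuals and their restrictions to the unit interval. -/

section Residual

variable {m : ℕ} {u : Fin m → ℝ → ℝ}

theorem residual_mem {f : ℝ → ℝ} {a b : ℝ} (ha : a ≤ -1) (hb : 1 ≤ b)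
    (hu : ∀ i, u i ∈ splinesOn 0 1) (hf : f ∈ splinesOn a b) : residual u f ∈ splinesOn a b := by
  refine sub_mem (sub_mem hf (sum_mem fun i _ => Submodule.smul_mem _ _ ?_))
    (sum_mem fun i _ => Submodule.smul_mem _ _ ?_)
  · exact splinesOn_mono (by linarith) hb (hu i)
  · exact splinesOn_mono ha (by linarith) (shift_mem_left (hu i))

theorem ip_residual {f h : ℝ → ℝ} (hf : MemLp f 2 volume) (hu : ∀ i, u i ∈ splinesOn 0 1)
    (hh : MemLp h 2 volume) : ip (residual u f) h = ip f h - ∑ i, ip f (u i) * ip (u i) h -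
      ∑ i, ip f (shift (u i)) * ip (shift (u i)) h := by
  have h1 : ∀ i, MemLp (ip f (u i) • u i) 2 volume := fun i =>
    (memLp_of_splinesOn (hu i)).const_smul _
  have h2 : ∀ i, MemLp (ip f (shift (u i)) • shift (u i)) 2 volume := fun i =>
    (memLp_of_splinesOn (shift_mem_left (hu i))).const_smul _
  have s1 : MemLp (∑ i, ip f (u i) • u i) 2 volume := memLp_finsetSum' _ fun i _ => h1 i
  have s2 : MemLp (∑ i, ip f (shift (u i)) • shift (u i)) 2 volume :=
    memLp_finsetSum' _ fun i _ => h2 i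
  rw [residual, ip_sub_left (hf.sub s1) s2 hh, ip_sub_left hf s1 hh,
    ip_sum_left _ (fun i _ => h1 i) hh, ip_sum_left _ (fun i _ => h2 i) hh]
  simp only [ip_smul_left]

theorem ip_residual_self {f : ℝ → ℝ} (hu : ∀ i, u i ∈ splinesOn 0 1)
    (horth : ∀ i j, ip (u i) (u j) = if i = j then 1 else 0)
    (hf : MemLp f 2 volume) (i : Fin m) : ip (residual u f) (u i) = 0 := by
  rw [ip_residual hf hu (memLp_of_splinesOn (hu i))]
  have h : ∀ j, ip (shift (u j)) (u i) = 0 := fun j =>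
    ip_eq_zero_of_splinesOn (shift_mem_left (hu j)) (hu i) le_rfl
  simp [h, horth]

theorem ip_residual_shift {f : ℝ → ℝ} (hu : ∀ i, u i ∈ splinesOn 0 1)
    (horth : ∀ i j, ip (u i) (u j) = if i = j then 1 else 0)
    (hf : MemLp f 2 volume) (i : Fin m) : ip (residual u f) (shift (u i)) = 0 := by
  rw [ip_residual hf hu (memLp_of_splinesOn (shift_mem_left (hu i)))]
  have h : ∀ j, ip (u j) (shift (u i)) = 0 := fun j => by
    rw [ip_comm]
    exact ip_eq_zero_of_splinesOn (shift_mem_left (hu i)) (hu j) le_rfl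
  simp [h, ip_shift_shift, horth]

/-- The residual on the unit interval. -/
theorem restrict_residual (hu : ∀ i, u i ∈ splinesOn 0 1) (f : ℝ → ℝ) :
    restrict (residual u f) = restrict f - ∑ i, ip (restrict f) (u i) • u i := by
  simp only [ip_restrict_left (hu _)]
  funext x
  by_cases hx : x ∈ Set.Icc (0 : ℝ) 1
  · have h : ∀ i, shift (u i) x = 0 := fun i => (shift_mem_left (hu i)).2 x (.inr hx.1)
    simp [restrict, Set.indicator_of_mem hx, residual, h]
  · have h : ∀ i, u i x = 0 := fun i => (hu i).2 x (by
      by_contra! h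
      exact hx ⟨h.1.le, h.2.le⟩)
    simp [restrict, Set.indicator_of_notMem hx, h]

/-- The right neighbour of the residual on the unit interval. -/
theorem restrict_residual_sub_one (hu : ∀ i, u i ∈ splinesOn 0 1) (f : ℝ → ℝ) :
    restrict (fun x => residual u f (x - 1)) =
      restrict (fun x => f (x - 1)) - ∑ i, ip (restrict fun x => f (x - 1)) (u i) • u i := by
  funext x
  by_cases hx : x ∈ Set.Icc (0 : ℝ) 1
  · have h : ∀ i, u i (x - 1) = 0 := fun i => (hu i).2 _ (.inl (by linarith [hx.2]))
    have h' : ∀ i, shift (u i) (x - 1) = u i x := fun i => by simp [shift]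
    have h'' : ∀ i, ip f (shift (u i)) = ip (restrict fun x => f (x - 1)) (u i) := fun i => by
      rw [ip_restrict_left (hu i), ip_comm, ip_shift_left, ip_comm]
    have e : residual u f (x - 1) = f (x - 1) -
        ∑ i, ip (restrict fun x => f (x - 1)) (u i) * u i x := by
      simp [residual, h, h', h'']
    simp only [restrict, Set.indicator_of_mem hx, Pi.sub_apply, Finset.sum_apply, Pi.smul_apply,
      smul_eq_mul] at e ⊢
    exact e
  · have h : ∀ i, u i x = 0 := fun i => (hu i).2 x (by
      by_contra! h
      exact hx ⟨h.1.le, h.2.le⟩)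
    simp [restrict, Set.indicator_of_notMem hx, h]

end Residual

/-- The supports meet only in `[0, 1]`. This localizes the pairing of an outer generator with its
right neighbour to the interval on which admissibility is formulated. -/
theorem ip_eq_ip_restrict {f g : ℝ → ℝ} (hf : f ∈ splinesOn (-1) 1) (hg : g ∈ splinesOn 0 2) :
    ip f g = ip (restrict f) (restrict g) := by
  refine integral_congr_ae (Filter.Eventually.of_forall fun x => ?_)
  by_cases hx : x ∈ Set.Icc (0 : ℝ) 1
  · simp [restrict, Set.indicator_of_mem hx]
  · have : f x * g x = 0 := by
      rcases le_total x 0 with h | h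
      · rw [hg.2 x (.inl h), mul_zero]
      · rw [hf.2 x (.inr (by
          by_contra! h'
          exact hx ⟨h, h'.le⟩)), zero_mul]
    simp [restrict, Set.indicator_of_notMem hx, this]

theorem xi_one_zero_mem : xi 1 0 ∈ splinesOn (-1) 1 :=
  ⟨xi_mem_c1Splines _ _, xi_supportedIn _ _ (by norm_num) (by norm_num)⟩

theorem xi_one_one_mem : xi 1 1 ∈ splinesOn (-1) 1 :=
  ⟨xi_mem_c1Splines _ _, xi_supportedIn _ _ (by norm_num) (by norm_num)⟩

theorem xi_one_two_mem : xi 1 2 ∈ splinesOn 0 1 :=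
  ⟨xi_mem_c1Splines _ _, xi_supportedIn _ _ (by norm_num) (by norm_num)⟩

theorem xi_one_three_mem : xi 1 3 ∈ splinesOn 0 1 :=
  ⟨xi_mem_c1Splines _ _, xi_supportedIn _ _ (by norm_num) (by norm_num)⟩

theorem xi_one_two_eq : xi 1 2 = halfSpline 0 0 (Real.sqrt 2) 0 0 0 := by
  funext x
  have := xi_one_apply_even 1 x
  norm_num at this
  simp [this, halfSpline]

theorem xi_one_three_eq : xi 1 3 = halfSpline 0 0 0 (Real.sqrt 2) 0 0 := by
  funext x
  have := xi_one_apply_odd 1 x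
  norm_num at this
  simp [this, halfSpline]

theorem ip_mid_mid (s t s' t' : ℝ) : ip (halfSpline 0 0 s t 0 0) (halfSpline 0 0 s' t' 0 0) =
    13 / 35 * s * s' + 1 / 105 * t * t' := by
  have := ip_halfSpline_mid_left 0 0 s t s' t'
  rw [restrict_halfSpline_mid] at this
  rw [this]
  ring

theorem ip_xi_one_two_pos : 0 < ip (xi 1 2) (xi 1 2) := by
  rw [xi_one_two_eq, ip_mid_mid]
  positivity

theorem ip_xi_one_three_pos : 0 < ip (xi 1 3) (xi 1 3) := by
  rw [xi_one_three_eq, ip_mid_mid]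
  positivity

theorem phi1_mem : phi1 ∈ spaceA0 := Submodule.smul_mem _ _ (Submodule.subset_span (by simp))

theorem phi2_mem : phi2 ∈ spaceA0 := Submodule.smul_mem _ _ (Submodule.subset_span (by simp))

theorem spaceA0_le : spaceA0 ≤ splinesOn 0 1 := by
  refine Submodule.span_le.2 ?_
  rintro f (rfl | rfl)
  · exact xi_one_two_mem
  · exact xi_one_three_mem

theorem spaceA0_eq_span_phi : spaceA0 = Submodule.span ℝ {phi1, phi2} := by
  have hn : ∀ {f : ℝ → ℝ}, 0 < ip f f → (l2norm f)⁻¹ ≠ 0 := fun hf =>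
    inv_ne_zero (Real.sqrt_pos.2 hf).ne'
  apply le_antisymm
  · refine Submodule.span_le.2 ?_
    rintro f (rfl | rfl)
    · have : xi 1 2 = ((l2norm (xi 1 2))⁻¹)⁻¹ • phi1 := by
        rw [phi1, normalize, inv_smul_smul₀ (hn ip_xi_one_two_pos)]
      rw [this]
      exact Submodule.smul_mem _ _ (Submodule.subset_span (by simp))
    · have : xi 1 3 = ((l2norm (xi 1 3))⁻¹)⁻¹ • phi2 := by
        rw [phi2, normalize, inv_smul_smul₀ (hn ip_xi_one_three_pos)]
      rw [this]
      exact Submodule.smul_mem _ _ (Submodule.subset_span (by simp))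
  · refine Submodule.span_le.2 ?_
    rintro f (rfl | rfl)
    · exact phi1_mem
    · exact phi2_mem

/-! ### Consequences of admissibility for the inner generators and the residuals. -/

variable {f3 f4 : ℝ → ℝ}

theorem IsAdmissible.mem_ominus_left (h : IsAdmissible f3 f4) : f3 ∈ ominus spaceA1 spaceA0 :=
  h.subset (Submodule.subset_span (by simp))

theorem IsAdmissible.mem_ominus_right (h : IsAdmissible f3 f4) : f4 ∈ ominus spaceA1 spaceA0 :=
  h.subset (Submodule.subset_span (by simp))

/-- The generators supported in the unit interval. -/
def innerGen (f3 f4 : ℝ → ℝ) : Fin 4 → ℝ → ℝ := ![phi1, phi2, f3, f4]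

theorem IsAdmissible.innerGen_mem (h : IsAdmissible f3 f4) (i : Fin 4) :
    innerGen f3 f4 i ∈ splinesOn 0 1 := by
  fin_cases i
  · exact spaceA0_le phi1_mem
  · exact spaceA0_le phi2_mem
  · exact spaceA1_le h.mem_ominus_left.1
  · exact spaceA1_le h.mem_ominus_right.1

theorem IsAdmissible.ip_innerGen (h : IsAdmissible f3 f4) (i j : Fin 4) :
    ip (innerGen f3 f4 i) (innerGen f3 f4 j) = if i = j then 1 else 0 := by
  have h12 : ip phi1 phi2 = 0 := by
    rw [phi1, phi2, normalize, normalize, ip_smul_left, ip_smul_right, xi_one_two_eq,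
      xi_one_three_eq, ip_mid_mid]
    ring
  have h11 : ip phi1 phi1 = 1 := ip_normalize_self ip_xi_one_two_pos
  have h22 : ip phi2 phi2 = 1 := ip_normalize_self ip_xi_one_three_pos
  have h31 := h.mem_ominus_left.2 _ phi1_mem
  have h32 := h.mem_ominus_left.2 _ phi2_mem
  have h41 := h.mem_ominus_right.2 _ phi1_mem
  have h42 := h.mem_ominus_right.2 _ phi2_mem
  have h21 := (ip_comm _ _).trans h12
  have h13 := (ip_comm _ _).trans h31
  have h23 := (ip_comm _ _).trans h32
  have h14 := (ip_comm _ _).trans h41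
  have h24 := (ip_comm _ _).trans h42
  have h33 := h.norm3
  have h44 := h.norm4
  have h34 := h.orth
  have h43 := (ip_comm _ _).trans h34
  fin_cases i <;> fin_cases j <;> simp [innerGen, *]

/-- Functions on the unit interval, projected to the complement of the inner generators. -/
theorem IsAdmissible.ip_sub_proj_eq_zero (h : IsAdmissible f3 f4) {f g : ℝ → ℝ}
    (hf : f ∈ spaceB0) (hg : g ∈ spaceB1) (hf2 : MemLp f 2 volume) (hg2 : MemLp g 2 volume) :
    ip (f - ∑ i, ip f (innerGen f3 f4 i) • innerGen f3 f4 i)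
      (g - ∑ i, ip g (innerGen f3 f4 i) • innerGen f3 f4 i) = 0 := by
  set u := innerGen f3 f4 with hu
  have hum : ∀ i, MemLp (u i) 2 volume := fun i => memLp_of_splinesOn (h.innerGen_mem i)
  have key : ∀ f : ℝ → ℝ, MemLp f 2 volume → ∀ B : Submodule ℝ (ℝ → ℝ), spaceA0 ≤ B → f ∈ B →
      ∃ v ∈ ominus B spaceA0, ∃ p, IsProj (Submodule.span ℝ {f3, f4}) v p ∧
        f - ∑ i, ip f (u i) • u i = v - p := by
    intro f hf2 B hB hf
    have hs : ∀ i, MemLp (ip f (u i) • u i) 2 volume := fun i => (hum i).const_smul _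
    have hperp : ∀ j, ip (f - ∑ i, ip f (u i) • u i) (u j) = 0 := fun j => by
      rw [ip_sub_left hf2 (memLp_finsetSum' _ fun i _ => hs i) (hum j),
        ip_sum_left _ (fun i _ => hs i) (hum j)]
      simp only [ip_smul_left]
      simp [hu, h.ip_innerGen]
    -- The first bracket removes the `A₀` component and leaves an element of `B ⊖ A₀`. The second
    -- bracket is the projection of that element onto `W`, because `W` is orthogonal to `A₀`.
    have hsum : f - ∑ i, ip f (u i) • u i =
        (f - (ip f phi1 • phi1 + ip f phi2 • phi2)) - (ip f f3 • f3 + ip f f4 • f4) := by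
      rw [Fin.sum_univ_four]
      simp only [hu, innerGen, Matrix.cons_val]
      abel
    have m1 : MemLp phi1 2 volume := hum 0
    have m2 : MemLp phi2 2 volume := hum 1
    have m3 : MemLp f3 2 volume := hum 2
    have m4 : MemLp f4 2 volume := hum 3
    have lv : MemLp (f - (ip f phi1 • phi1 + ip f phi2 • phi2)) 2 volume :=
      hf2.sub ((m1.const_smul _).add (m2.const_smul _))
    have lp : MemLp (ip f f3 • f3 + ip f f4 • f4) 2 volume :=
      (m3.const_smul _).add (m4.const_smul _)
    rw [hsum] at hperp ⊢
    refine ⟨_, ⟨sub_mem hf (hB (add_mem (Submodule.smul_mem _ _ phi1_mem)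
      (Submodule.smul_mem _ _ phi2_mem))), fun g hg => ?_⟩, _,
      ⟨Submodule.mem_span_pair.2 ⟨_, _, rfl⟩,
      fun w hw => ?_⟩, rfl⟩
    · have hpg : ip (ip f f3 • f3 + ip f f4 • f4) g = 0 := by
        rw [ip_add_left (m3.const_smul _) (m4.const_smul _) (memLp_of_splinesOn (spaceA0_le hg)),
          ip_smul_left, ip_smul_left]
        rw [h.mem_ominus_left.2 g hg, h.mem_ominus_right.2 g hg]
        ring
      rw [spaceA0_eq_span_phi] at hg
      obtain ⟨a, b, rfl⟩ := Submodule.mem_span_pair.1 hg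
      have lg : MemLp (a • phi1 + b • phi2) 2 volume := (m1.const_smul a).add (m2.const_smul b)
      have h1 := hperp 0
      have h2 := hperp 1
      have h3 : ip ((f - (ip f phi1 • phi1 + ip f phi2 • phi2)) - (ip f f3 • f3 + ip f f4 • f4))
          (a • phi1 + b • phi2) = 0 := by
        rw [ip_add_right (m1.const_smul a) (m2.const_smul b) (lv.sub lp), ip_smul_right,
          ip_smul_right]
        exact (congrArg₂ (fun x y => a * x + b * y) h1 h2).trans (by ring)
      rwa [ip_sub_left lv lp lg, hpg, sub_zero] at h3
    · obtain ⟨a, b, rfl⟩ := Submodule.mem_span_pair.1 hw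
      rw [ip_add_right (m3.const_smul a) (m4.const_smul b) (lv.sub lp), ip_smul_right,
          ip_smul_right]
      exact (congrArg₂ (fun x y => a * x + b * y) (hperp 2) (hperp 3)).trans (by ring)
  obtain ⟨v, hv, p, hp, e1⟩ := key f hf2 spaceB0
    (fun x hx => Submodule.subset_span (.inr hx)) hf
  obtain ⟨w, hw, q, hq, e2⟩ := key g hg2 spaceB1
    (fun x hx => Submodule.subset_span (.inr hx)) hg
  rw [e1, e2]
  exact h.cond v hv w hw p q hp hq

theorem xi_one_zero_sub_one : (fun x => xi 1 0 (x - 1)) = xi 1 4 := by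
  funext x
  have h0 := xi_one_apply_even 0 (x - 1)
  have h4 := xi_one_apply_even 2 x
  norm_num at h0 h4
  rw [h0, h4]
  ring_nf

theorem xi_one_one_sub_one : (fun x => xi 1 1 (x - 1)) = xi 1 5 := by
  funext x
  have h0 := xi_one_apply_odd 0 (x - 1)
  have h4 := xi_one_apply_odd 2 x
  norm_num at h0 h4
  rw [h0, h4]
  ring_nf

/-- The residuals of `ξ_{1,0}` and `ξ_{1,1}` are orthogonal to each other's right neighbours. -/
theorem IsAdmissible.ip_residual_residual_sub_one (h : IsAdmissible f3 f4) {f g : ℝ → ℝ}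
    (hf : f = xi 1 0 ∨ f = xi 1 1) (hg : g = xi 1 0 ∨ g = xi 1 1) :
    ip (residual (innerGen f3 f4) f) (fun x => residual (innerGen f3 f4) g (x - 1)) = 0 := by
  have hfm : f ∈ splinesOn (-1) 1 := by
    rcases hf with rfl | rfl
    exacts [xi_one_zero_mem, xi_one_one_mem]
  have hgm : g ∈ splinesOn (-1) 1 := by
    rcases hg with rfl | rfl
    exacts [xi_one_zero_mem, xi_one_one_mem]
  have h2 := comp_sub_mem_splinesOn (residual_mem le_rfl le_rfl h.innerGen_mem hgm) 1
  norm_num at h2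
  rw [ip_eq_ip_restrict (residual_mem le_rfl le_rfl h.innerGen_mem hfm) h2,
    restrict_residual h.innerGen_mem, restrict_residual_sub_one h.innerGen_mem]
  have h3 := comp_sub_mem_splinesOn hgm 1
  refine h.ip_sub_proj_eq_zero ?_ ?_ (memLp_restrict (memLp_of_splinesOn hfm))
    (memLp_restrict (memLp_of_splinesOn h3))
  · rcases hf with rfl | rfl
    · exact Submodule.subset_span (.inl (by simp))
    · exact Submodule.subset_span (.inl (by simp))
  · rcases hg with rfl | rfl
    · rw [xi_one_zero_sub_one]
      exact Submodule.subset_span (.inl (by simp))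
    · rw [xi_one_one_sub_one]
      exact Submodule.subset_span (.inl (by simp))

/-! ### The generators supported in `[-1, 1]` -/

/-- A `C¹` function already has a derivative at `x`, and its value is determined on one side.
Derivatives at a knot can thus be computed from a single polynomial piece. -/
theorem hasDerivAt_of_eqOn_Icc {f p : ℝ → ℝ} {a b x d : ℝ} (hab : a < b) (hx : x ∈ Set.Icc a b)
    (hf : ContDiff ℝ 1 f) (h : Set.EqOn f p (Set.Icc a b)) (hp : HasDerivAt p d x) :
    HasDerivAt f d x := by
  have h1 := (hf.differentiable one_ne_zero x).hasDerivAt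
  have h2 : HasDerivWithinAt f d (Set.Icc a b) x :=
    hp.hasDerivWithinAt.congr h (h hx)
  have h3 := (uniqueDiffOn_Icc hab x hx).eq_deriv _ h1.hasDerivWithinAt h2
  rwa [h3] at h1

theorem hasDerivAt_zero_of_splinesOn_right {f : ℝ → ℝ} {b : ℝ} (hf : f ∈ splinesOn 0 b) :
    HasDerivAt f 0 0 :=
  hasDerivAt_of_eqOn_Icc (a := -1) (b := 0) (p := fun _ => 0) (by norm_num) (by simp) hf.1.2
    (fun x hx => hf.2 x (.inl hx.2)) (hasDerivAt_const _ _)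

theorem hasDerivAt_zero_of_splinesOn_left {f : ℝ → ℝ} {a : ℝ} (hf : f ∈ splinesOn a 0) :
    HasDerivAt f 0 0 :=
  hasDerivAt_of_eqOn_Icc (a := 0) (b := 1) (p := fun _ => 0) (by norm_num) (by simp) hf.1.2
    (fun x hx => hf.2 x (.inr hx.1)) (hasDerivAt_const _ _)

theorem hasDerivAt_residual {m : ℕ} {u : Fin m → ℝ → ℝ} (hu : ∀ i, u i ∈ splinesOn 0 1)
    {f : ℝ → ℝ} {d : ℝ} (hf : HasDerivAt f d 0) : HasDerivAt (residual u f) d 0 := by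
  have h1 : HasDerivAt (∑ i, ip f (u i) • u i) (∑ i, ip f (u i) • (0 : ℝ)) 0 :=
    HasDerivAt.sum fun i _ => (hasDerivAt_zero_of_splinesOn_right (hu i)).const_smul _
  have h2 : HasDerivAt (∑ i, ip f (shift (u i)) • shift (u i))
      (∑ i, ip f (shift (u i)) • (0 : ℝ)) 0 :=
    HasDerivAt.sum fun i _ =>
      (hasDerivAt_zero_of_splinesOn_left (shift_mem_left (hu i))).const_smul _
  simpa [residual] using (hf.sub h1).sub h2

theorem residual_apply_zero {m : ℕ} {u : Fin m → ℝ → ℝ} (hu : ∀ i, u i ∈ splinesOn 0 1)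
    (f : ℝ → ℝ) : residual u f 0 = f 0 := by
  have h1 : ∀ i, u i 0 = 0 := fun i => (hu i).2 0 (.inl le_rfl)
  have h2 : ∀ i, shift (u i) 0 = 0 := fun i => (shift_mem_left (hu i)).2 0 (.inr le_rfl)
  simp [residual, h1, h2]

theorem xi_one_zero_apply_zero : xi 1 0 0 = Real.sqrt 2 := by
  have := xi_one_apply_even 0 0
  norm_num [hermite1] at this
  exact this

theorem hasDerivAt_xi_one_zero : HasDerivAt (xi 1 0) 0 0 := by
  refine hasDerivAt_of_eqOn_Icc (a := 0) (b := 1 / 2)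
    (p := fun x => Real.sqrt 2 * ((1 - 2 * x) ^ 2 * (1 + 2 * (2 * x)))) (by norm_num) (by norm_num)
    (xi_mem_c1Splines 1 0).2 (fun x hx => ?_) ?_
  · have := xi_one_apply_even 0 x
    norm_num at this
    rw [this, hermite1_right (by linarith [hx.1]) (by linarith [hx.2])]
  · have h1 : HasDerivAt (fun x : ℝ => 1 - 2 * x) (-2) 0 := by
      simpa using ((hasDerivAt_id (0 : ℝ)).const_mul 2).const_sub 1
    have h2 : HasDerivAt (fun x : ℝ => 1 + 2 * (2 * x)) 4 0 := by
      exact ((((hasDerivAt_id (0 : ℝ)).const_mul 2).const_mul 2).const_add 1).congr_deriv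
        (by norm_num)
    have := ((h1.pow 2).mul h2).const_mul (Real.sqrt 2)
    refine this.congr_deriv ?_
    norm_num

theorem hasDerivAt_xi_one_one : HasDerivAt (xi 1 1) (Real.sqrt 2 * 2) 0 := by
  refine hasDerivAt_of_eqOn_Icc (a := 0) (b := 1 / 2)
    (p := fun x => Real.sqrt 2 * ((1 - 2 * x) ^ 2 * (2 * x))) (by norm_num) (by norm_num)
    (xi_mem_c1Splines 1 1).2 (fun x hx => ?_) ?_
  · have := xi_one_apply_odd 0 x
    norm_num at this
    rw [this, hermite2_right (by linarith [hx.1]) (by linarith [hx.2])]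
  · have h1 : HasDerivAt (fun x : ℝ => 1 - 2 * x) (-2) 0 := by
      simpa using ((hasDerivAt_id (0 : ℝ)).const_mul 2).const_sub 1
    have h2 : HasDerivAt (fun x : ℝ => 2 * x) 2 0 := by
      simpa using (hasDerivAt_id (0 : ℝ)).const_mul 2
    have := ((h1.pow 2).mul h2).const_mul (Real.sqrt 2)
    refine this.congr_deriv ?_
    norm_num

/-- The residual of `ξ_{1,0}`. -/
def res0 (f3 f4 : ℝ → ℝ) : ℝ → ℝ := residual (innerGen f3 f4) (xi 1 0)

/-- The residual of `ξ_{1,1}` with respect to the inner generators. -/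
def res1 (f3 f4 : ℝ → ℝ) : ℝ → ℝ := residual (innerGen f3 f4) (xi 1 1)

/-- Both `φ₅` and `φ₆` lie in the span of the two residuals. The properties needed are linear, so
they are proved once on the span. -/
theorem IsAdmissible.of_mem_span_res (h : IsAdmissible f3 f4) {g : ℝ → ℝ}
    (hg : g ∈ Submodule.span ℝ {res0 f3 f4, res1 f3 f4}) : g ∈ splinesOn (-1) 1 ∧
      (∀ i, ip g (innerGen f3 f4 i) = 0) ∧ ∀ i, ip g (shift (innerGen f3 f4 i)) = 0 := by
  obtain ⟨a, b, rfl⟩ := Submodule.mem_span_pair.1 hg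
  have m0 : res0 f3 f4 ∈ splinesOn (-1) 1 :=
    residual_mem le_rfl le_rfl h.innerGen_mem xi_one_zero_mem
  have m1 : res1 f3 f4 ∈ splinesOn (-1) 1 :=
    residual_mem le_rfl le_rfl h.innerGen_mem xi_one_one_mem
  have l0 := (memLp_of_splinesOn m0).const_smul a
  have l1 := (memLp_of_splinesOn m1).const_smul b
  have k0 := memLp_of_splinesOn xi_one_zero_mem
  have k1 := memLp_of_splinesOn xi_one_one_mem
  refine ⟨add_mem (Submodule.smul_mem _ _ m0) (Submodule.smul_mem _ _ m1), fun i => ?_, fun i => ?_⟩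
  · rw [ip_add_left l0 l1 (memLp_of_splinesOn (h.innerGen_mem i)), ip_smul_left, ip_smul_left,
      res0, res1, ip_residual_self h.innerGen_mem h.ip_innerGen k0,
      ip_residual_self h.innerGen_mem h.ip_innerGen k1]
    ring
  · rw [ip_add_left l0 l1 (memLp_of_splinesOn (shift_mem_left (h.innerGen_mem i))), ip_smul_left,
      ip_smul_left, res0, res1, ip_residual_shift h.innerGen_mem h.ip_innerGen k0,
      ip_residual_shift h.innerGen_mem h.ip_innerGen k1]
    ring

theorem IsAdmissible.ip_sub_one_of_mem_span_res (h : IsAdmissible f3 f4) {g g' : ℝ → ℝ}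
    (hg : g ∈ Submodule.span ℝ {res0 f3 f4, res1 f3 f4})
    (hg' : g' ∈ Submodule.span ℝ {res0 f3 f4, res1 f3 f4}) :
    ip g (fun x => g' (x - 1)) = 0 := by
  have m0 : res0 f3 f4 ∈ splinesOn (-1) 1 :=
    residual_mem le_rfl le_rfl h.innerGen_mem xi_one_zero_mem
  have m1 : res1 f3 f4 ∈ splinesOn (-1) 1 :=
    residual_mem le_rfl le_rfl h.innerGen_mem xi_one_one_mem
  have n0 := memLp_of_splinesOn (comp_sub_mem_splinesOn m0 1)
  have n1 := memLp_of_splinesOn (comp_sub_mem_splinesOn m1 1)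
  have lg' := memLp_of_splinesOn (comp_sub_mem_splinesOn (h.of_mem_span_res hg').1 1)
  obtain ⟨a, b, rfl⟩ := Submodule.mem_span_pair.1 hg
  obtain ⟨c, d, rfl⟩ := Submodule.mem_span_pair.1 hg'
  have e : (fun x => (c • res0 f3 f4 + d • res1 f3 f4) (x - 1)) =
      (c • fun x => res0 f3 f4 (x - 1)) + d • fun x => res1 f3 f4 (x - 1) := rfl
  have l0 := memLp_of_splinesOn m0
  have l1 := memLp_of_splinesOn m1
  rw [ip_add_left (l0.const_smul a) (l1.const_smul b) lg', ip_smul_left, ip_smul_left, e,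
    ip_add_right (n0.const_smul c) (n1.const_smul d) l0,
    ip_add_right (n0.const_smul c) (n1.const_smul d) l1]
  simp only [ip_smul_right, res0, res1]
  rw [h.ip_residual_residual_sub_one (.inl rfl) (.inl rfl),
    h.ip_residual_residual_sub_one (.inl rfl) (.inr rfl),
    h.ip_residual_residual_sub_one (.inr rfl) (.inl rfl),
    h.ip_residual_residual_sub_one (.inr rfl) (.inr rfl)]
  ring

theorem phi5_mem_span : phi5 f3 f4 ∈ Submodule.span ℝ {res0 f3 f4, res1 f3 f4} :=
  Submodule.smul_mem _ _ (Submodule.subset_span (.inl rfl))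

/-- Because `φ₅` is orthogonal to the inner generators and their left shifts, its coefficient is the
same for `ξ_{1,1}` as for its residual. The coefficient of `φ₅(· + 1)` vanishes by admissibility, so
`g₆` is an ordinary Gram-Schmidt step. -/
theorem IsAdmissible.residual_five (h : IsAdmissible f3 f4) :
    residual ![phi1, phi2, f3, f4, phi5 f3 f4] (xi 1 1) =
      res1 f3 f4 - ip (res1 f3 f4) (phi5 f3 f4) • phi5 f3 f4 := by
  obtain ⟨m5, p5, s5⟩ := h.of_mem_span_res phi5_mem_span
  have l := memLp_of_splinesOn xi_one_one_mem
  have hs := shift_mem_splinesOn m5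
  norm_num at hs
  have h1 : ip (xi 1 1) (phi5 f3 f4) = ip (res1 f3 f4) (phi5 f3 f4) := by
    rw [res1, ip_residual l h.innerGen_mem (memLp_of_splinesOn m5)]
    simp only [ip_comm _ (phi5 f3 f4), p5, s5]
    simp
  have h2 : ip (xi 1 1) (shift (phi5 f3 f4)) = 0 := by
    have h3 : ip (res1 f3 f4) (shift (phi5 f3 f4)) = 0 := by
      rw [ip_comm, ip_shift_left]
      exact h.ip_sub_one_of_mem_span_res phi5_mem_span (Submodule.subset_span (.inr rfl))
    have h4 : ∀ i, ip (innerGen f3 f4 i) (shift (phi5 f3 f4)) = 0 := fun i => by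
      rw [ip_comm]
      exact ip_eq_zero_of_splinesOn hs (h.innerGen_mem i) le_rfl
    rw [res1, ip_residual l h.innerGen_mem (memLp_of_splinesOn hs)] at h3
    simp only [ip_shift_shift, h4, ip_comm _ (phi5 f3 f4), p5] at h3
    simpa using h3
  rw [← h1]
  funext x
  simp [residual, res1, innerGen, Fin.sum_univ_succ, h2]
  ring

theorem IsAdmissible.ip_res0_pos (h : IsAdmissible f3 f4) : 0 < ip (res0 f3 f4) (res0 f3 f4) := by
  have m0 : res0 f3 f4 ∈ splinesOn (-1) 1 :=
    residual_mem le_rfl le_rfl h.innerGen_mem xi_one_zero_mem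
  refine ip_self_pos m0.1.2.continuous (hasCompactSupport_of_supportedIn m0.2) (x := 0) ?_
  rw [res0, residual_apply_zero h.innerGen_mem, xi_one_zero_apply_zero]
  positivity

/-- The function `g₆`. -/
def res6 (f3 f4 : ℝ → ℝ) : ℝ → ℝ := res1 f3 f4 - ip (res1 f3 f4) (phi5 f3 f4) • phi5 f3 f4

theorem IsAdmissible.phi6_eq (h : IsAdmissible f3 f4) :
    phi6 f3 f4 = normalize (res6 f3 f4) := by
  rw [phi6, h.residual_five, res6]

theorem res6_mem_span : res6 f3 f4 ∈ Submodule.span ℝ {res0 f3 f4, res1 f3 f4} :=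
  sub_mem (Submodule.subset_span (.inr rfl)) (Submodule.smul_mem _ _ phi5_mem_span)

/-- The derivative at `0` separates `g₆` from zero: the inner generators, their shifts and `φ₅` all
have derivative zero there, while that of `ξ_{1,1}` is `2√2`. -/
theorem IsAdmissible.ip_res6_pos (h : IsAdmissible f3 f4) : 0 < ip (res6 f3 f4) (res6 f3 f4) := by
  have m6 := (h.of_mem_span_res res6_mem_span).1
  have hd : HasDerivAt (res6 f3 f4) (Real.sqrt 2 * 2) 0 := by
    have h1 := hasDerivAt_residual h.innerGen_mem hasDerivAt_xi_one_one
    have h2 := ((hasDerivAt_residual h.innerGen_mem hasDerivAt_xi_one_zero).const_smul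
      (l2norm (res0 f3 f4))⁻¹).const_smul (ip (res1 f3 f4) (phi5 f3 f4))
    have := h1.sub h2
    rw [smul_zero, smul_zero, sub_zero] at this
    exact this
  obtain ⟨x, hx⟩ : ∃ x, res6 f3 f4 x ≠ 0 := by
    by_contra! hz
    have e : res6 f3 f4 = fun _ => 0 := funext hz
    rw [e] at hd
    have := hd.unique (hasDerivAt_const 0 0)
    have : 0 < Real.sqrt 2 * 2 := by positivity
    linarith
  exact ip_self_pos m6.1.2.continuous (hasCompactSupport_of_supportedIn m6.2) hx

/-- The generators supported in `[-1, 1]`. -/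
def outerGen (f3 f4 : ℝ → ℝ) : Fin 2 → ℝ → ℝ := ![phi5 f3 f4, phi6 f3 f4]

theorem IsAdmissible.outerGen_mem_span (h : IsAdmissible f3 f4) (i : Fin 2) :
    outerGen f3 f4 i ∈ Submodule.span ℝ {res0 f3 f4, res1 f3 f4} := by
  fin_cases i
  · exact phi5_mem_span
  · change phi6 f3 f4 ∈ _
    rw [h.phi6_eq]
    exact Submodule.smul_mem _ _ res6_mem_span

theorem IsAdmissible.ip_outerGen (h : IsAdmissible f3 f4) (i j : Fin 2) :
    ip (outerGen f3 f4 i) (outerGen f3 f4 j) = if i = j then 1 else 0 := by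
  have h55 : ip (phi5 f3 f4) (phi5 f3 f4) = 1 := ip_normalize_self h.ip_res0_pos
  have h66 : ip (phi6 f3 f4) (phi6 f3 f4) = 1 := by
    rw [h.phi6_eq]
    exact ip_normalize_self h.ip_res6_pos
  have h65 : ip (phi6 f3 f4) (phi5 f3 f4) = 0 := by
    have l5 := memLp_of_splinesOn (h.of_mem_span_res phi5_mem_span).1
    have l1 := memLp_of_splinesOn (h.of_mem_span_res (g := res1 f3 f4)
      (Submodule.subset_span (.inr rfl))).1
    rw [h.phi6_eq, normalize, ip_smul_left, res6, ip_sub_left l1 (l5.const_smul _) l5, ip_smul_left,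
      h55]
    ring
  have h56 := (ip_comm _ _).trans h65
  fin_cases i <;> fin_cases j <;> simp [outerGen, *]

/-! ### Orthonormality of the integer translates -/

theorem generators_cases (f3 f4 : ℝ → ℝ) (i : Fin 6) :
    (∃ a : Fin 4, i = a.castAdd 2 ∧ generators f3 f4 i = innerGen f3 f4 a) ∨
      ∃ b : Fin 2, i = b.natAdd 4 ∧ generators f3 f4 i = outerGen f3 f4 b := by
  fin_cases i
  · exact .inl ⟨0, rfl, rfl⟩
  · exact .inl ⟨1, rfl, rfl⟩
  · exact .inl ⟨2, rfl, rfl⟩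
  · exact .inl ⟨3, rfl, rfl⟩
  · exact .inr ⟨0, rfl, rfl⟩
  · exact .inr ⟨1, rfl, rfl⟩

theorem IsAdmissible.generators_mem (h : IsAdmissible f3 f4) (i : Fin 6) :
    generators f3 f4 i ∈ splinesOn (-1) 1 := by
  rcases generators_cases f3 f4 i with ⟨a, -, e⟩ | ⟨b, -, e⟩
  · rw [e]
    exact splinesOn_mono (by norm_num) le_rfl (h.innerGen_mem a)
  · rw [e]
    exact (h.of_mem_span_res (h.outerGen_mem_span b)).1

theorem IsAdmissible.ip_generators (h : IsAdmissible f3 f4) (i j : Fin 6) :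
    ip (generators f3 f4 i) (generators f3 f4 j) = if i = j then 1 else 0 := by
  rcases generators_cases f3 f4 i with ⟨a, rfl, e⟩ | ⟨b, rfl, e⟩ <;>
  rcases generators_cases f3 f4 j with ⟨a', rfl, e'⟩ | ⟨b', rfl, e'⟩ <;> rw [e, e']
  · simp only [h.ip_innerGen, (Fin.castAdd_injective 4 2).eq_iff]
  · rw [ip_comm, (h.of_mem_span_res (h.outerGen_mem_span b')).2.1, if_neg]
    intro hh
    have := congrArg Fin.val hh
    simp at this
    omega
  · rw [(h.of_mem_span_res (h.outerGen_mem_span b)).2.1, if_neg]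
    intro hh
    have := congrArg Fin.val hh
    simp at this
    omega
  · simp only [h.ip_outerGen, (Fin.natAdd_injective 2 4).eq_iff]

theorem IsAdmissible.ip_generators_sub_one (h : IsAdmissible f3 f4) (i j : Fin 6) :
    ip (generators f3 f4 i) (fun x => generators f3 f4 j (x - 1)) = 0 := by
  rcases generators_cases f3 f4 j with ⟨a', -, e'⟩ | ⟨b', -, e'⟩
  · rw [e']
    exact ip_eq_zero_of_splinesOn (h.generators_mem i)
      (comp_sub_mem_splinesOn (h.innerGen_mem a') 1) (by norm_num)
  · rw [e']
    rcases generators_cases f3 f4 i with ⟨a, -, e⟩ | ⟨b, -, e⟩ <;> rw [e]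
    · rw [← ip_shift_left, ip_comm]
      exact (h.of_mem_span_res (h.outerGen_mem_span b')).2.2 a
    · exact h.ip_sub_one_of_mem_span_res (h.outerGen_mem_span b) (h.outerGen_mem_span b')

theorem IsAdmissible.ip_generators_sub_int (h : IsAdmissible f3 f4) (i j : Fin 6) {m : ℤ}
    (hm : 0 < m) : ip (generators f3 f4 i) (fun x => generators f3 f4 j (x - m)) = 0 := by
  rcases (Int.add_one_le_iff.2 hm).eq_or_lt with h1 | h1
  · have : (m : ℝ) = 1 := by exact_mod_cast h1.symm
    rw [this]
    exact h.ip_generators_sub_one i j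
  · have : (2 : ℝ) ≤ m := by exact_mod_cast (by omega : (2 : ℤ) ≤ m)
    exact ip_eq_zero_of_splinesOn (h.generators_mem i)
      (comp_sub_mem_splinesOn (h.generators_mem j) m) (by linarith)

theorem IsAdmissible.ip_generators_translates (h : IsAdmissible f3 f4) (p q : Fin 6 × ℤ) :
    ip (fun x => generators f3 f4 p.1 (x - p.2)) (fun x => generators f3 f4 q.1 (x - q.2)) =
      if p = q then 1 else 0 := by
  obtain ⟨i, k⟩ := p
  obtain ⟨j, l⟩ := q
  simp only [Prod.mk.injEq]
  rcases lt_trichotomy k l with hkl | rfl | hkl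
  · rw [if_neg (fun hh => hkl.ne hh.2), ip_sub_int]
    have := h.ip_generators_sub_int i j (sub_pos.2 hkl)
    push_cast at this
    exact this
  · rw [ip_comp_sub, h.ip_generators]
    simp
  · rw [if_neg (fun hh => hkl.ne hh.2.symm), ip_comm, ip_sub_int]
    have := h.ip_generators_sub_int j i (sub_pos.2 hkl)
    push_cast at this
    exact this

/-! ### Integer translates -/

/-- Translation of functions. -/
def transl (k : ℤ) : (ℝ → ℝ) →ₗ[ℝ] (ℝ → ℝ) := LinearMap.funLeft ℝ ℝ fun x => x - k

theorem transl_mem_span {ι : Type*} {F : ι → ℝ → ℝ} {k : ℤ}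
    (h : ∀ i, transl k (F i) ∈ Submodule.span ℝ (Set.range F)) {f : ℝ → ℝ}
    (hf : f ∈ Submodule.span ℝ (Set.range F)) : transl k f ∈ Submodule.span ℝ (Set.range F) := by
  have : Submodule.span ℝ (Set.range F) ≤ (Submodule.span ℝ (Set.range F)).comap (transl k) :=
    Submodule.span_le.2 (by rintro _ ⟨i, rfl⟩; exact h i)
  exact this hf

theorem transl_xi_one (k n : ℤ) : transl k (xi 1 n) = xi 1 (n + 4 * k) := by
  funext x
  have h1 : (n + 4 * k) / 2 = n / 2 + 2 * k := by omega
  have h2 : (n + 4 * k) % 2 = n % 2 := by omega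
  simp only [transl, LinearMap.funLeft_apply, xi_one, Pi.smul_apply, h1, h2]
  congr 2
  push_cast
  ring_nf

theorem transl_xi_two (k n : ℤ) : transl k (xi 2 n) = xi 2 (n + 8 * k) := by
  funext x
  have h1 : (n + 8 * k) / 2 = n / 2 + 4 * k := by omega
  have h2 : (n + 8 * k) % 2 = n % 2 := by omega
  simp only [transl, LinearMap.funLeft_apply, xi_two, Pi.smul_apply, h1, h2]
  congr 2
  push_cast
  ring_nf

/-- The integer translates of the generators. -/
def translates (f3 f4 : ℝ → ℝ) (p : Fin 6 × ℤ) : ℝ → ℝ := transl p.2 (generators f3 f4 p.1)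

theorem scalingFun_zero (φ : Fin 6 → ℝ → ℝ) (n : ℤ) :
    ∃ p : Fin 6 × ℤ, scalingFun φ 0 n = transl p.2 (φ p.1) := by
  refine ⟨(Fin.ofNat 6 ((n - 1) % 6).toNat, (n - 1) / 6 + if (n - 1) % 6 < 4 then 0 else 1), ?_⟩
  funext x
  simp only [scalingFun, transl, LinearMap.funLeft_apply]
  simp
  congr 1
  split_ifs <;> ring_nf

theorem exists_scalingFun_zero_eq (φ : Fin 6 → ℝ → ℝ) (p : Fin 6 × ℤ) :
    ∃ n, scalingFun φ 0 n = transl p.2 (φ p.1) := by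
  obtain ⟨i, k⟩ := p
  -- The block index is lowered by one for `φ₅, φ₆` to compensate for their extra translation; the
  -- final `1` accounts for numbering the functions in a block from one.
  refine ⟨6 * (k - if (i : ℕ) < 4 then 0 else 1) + i + 1, ?_⟩
  have hi := i.2
  set c : ℤ := if (i : ℕ) < 4 then 0 else 1 with hc
  have h1 : (6 * (k - c) + i + 1 - 1) % 6 = i := by omega
  have h2 : (6 * (k - c) + i + 1 - 1) / 6 = k - c := by omega
  have h3 : Fin.ofNat 6 ((i : ℕ) : ℤ).toNat = i := by
    apply Fin.ext
    simp
  funext x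
  simp only [scalingFun, transl, LinearMap.funLeft_apply, h1, h2, h3]
  have h4 : ((i : ℕ) : ℤ) < 4 ↔ (i : ℕ) < 4 := by omega
  simp only [h4, hc]
  simp
  congr 1
  split_ifs <;> ring_nf

theorem range_scalingFun_zero (f3 f4 : ℝ → ℝ) :
    Set.range (scalingFun (generators f3 f4) 0) = Set.range (translates f3 f4) := by
  apply Set.Subset.antisymm
  · rintro _ ⟨n, rfl⟩
    obtain ⟨p, hp⟩ := scalingFun_zero (generators f3 f4) n
    exact ⟨p, hp.symm⟩
  · rintro _ ⟨p, rfl⟩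
    obtain ⟨n, hn⟩ := exists_scalingFun_zero_eq (generators f3 f4) p
    exact ⟨n, hn⟩

theorem IsAdmissible.translates_mem (h : IsAdmissible f3 f4) (p : Fin 6 × ℤ) :
    translates f3 f4 p ∈ splinesOn (-1 + p.2) (1 + p.2) :=
  comp_sub_mem_splinesOn (h.generators_mem p.1) p.2

theorem IsAdmissible.memLp_translates (h : IsAdmissible f3 f4) (p : Fin 6 × ℤ) :
    MemLp (translates f3 f4 p) 2 volume := memLp_of_splinesOn (h.translates_mem p)

theorem transl_translates (k : ℤ) (p : Fin 6 × ℤ) :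
    transl k (translates f3 f4 p) = translates f3 f4 (p.1, p.2 + k) := by
  funext x
  simp only [translates, transl, LinearMap.funLeft_apply]
  congr 1
  push_cast
  ring

theorem transl_mem_span_translates {f : ℝ → ℝ} (k : ℤ)
    (hf : f ∈ Submodule.span ℝ (Set.range (translates f3 f4))) :
    transl k f ∈ Submodule.span ℝ (Set.range (translates f3 f4)) :=
  transl_mem_span (fun p => by
    rw [transl_translates]
    exact Submodule.subset_span ⟨_, rfl⟩) hf

theorem generators_mem_span (i : Fin 6) :
    generators f3 f4 i ∈ Submodule.span ℝ (Set.range (translates f3 f4)) := by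
  refine Submodule.subset_span ⟨(i, 0), ?_⟩
  funext x
  simp [translates, transl, LinearMap.funLeft_apply]

theorem shift_eq_transl (f : ℝ → ℝ) : shift f = transl (-1) f := by
  funext x
  simp [shift, transl, LinearMap.funLeft_apply]

theorem eq_smul_normalize {f : ℝ → ℝ} (hf : 0 < ip f f) : f = l2norm f • normalize f := by
  rw [normalize, smul_inv_smul₀]
  exact (Real.sqrt_pos.2 hf).ne'

theorem mem_of_residual_mem {m : ℕ} {u : Fin m → ℝ → ℝ} {f : ℝ → ℝ} {T : Submodule ℝ (ℝ → ℝ)}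
    (hr : residual u f ∈ T) (hu : ∀ i, u i ∈ T) (hs : ∀ i, shift (u i) ∈ T) : f ∈ T := by
  have : f = residual u f + ∑ i, ip f (u i) • u i + ∑ i, ip f (shift (u i)) • shift (u i) := by
    rw [residual]
    abel
  rw [this]
  exact add_mem (add_mem hr (sum_mem fun i _ => Submodule.smul_mem _ _ (hu i)))
    (sum_mem fun i _ => Submodule.smul_mem _ _ (hs i))

/-- The Hermite splines with knots in `ℤ / 2` are combinations of the translates. -/
theorem IsAdmissible.xi_one_mem_span (h : IsAdmissible f3 f4) (n : ℤ) :
    xi 1 n ∈ Submodule.span ℝ (Set.range (translates f3 f4)) := by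
  set T := Submodule.span ℝ (Set.range (translates f3 f4)) with hT
  have hshift : ∀ {f : ℝ → ℝ}, f ∈ T → shift f ∈ T := fun hf => by
    rw [shift_eq_transl]
    exact transl_mem_span_translates _ hf
  have hu : ∀ i, innerGen f3 f4 i ∈ T := fun i => by
    fin_cases i
    · exact generators_mem_span 0
    · exact generators_mem_span 1
    · exact generators_mem_span 2
    · exact generators_mem_span 3
  have h5 : phi5 f3 f4 ∈ T := generators_mem_span 4
  have h6 : phi6 f3 f4 ∈ T := generators_mem_span 5
  have h0 : xi 1 0 ∈ T := by
    refine mem_of_residual_mem (u := innerGen f3 f4) ?_ hu fun i => hshift (hu i)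
    change res0 f3 f4 ∈ T
    rw [eq_smul_normalize h.ip_res0_pos]
    exact Submodule.smul_mem _ _ h5
  have h1 : xi 1 1 ∈ T := by
    refine mem_of_residual_mem (u := innerGen f3 f4) ?_ hu fun i => hshift (hu i)
    change res1 f3 f4 ∈ T
    have hr : res1 f3 f4 = res6 f3 f4 + ip (res1 f3 f4) (phi5 f3 f4) • phi5 f3 f4 := by
      rw [res6, sub_add_cancel]
    rw [hr]
    refine add_mem ?_ (Submodule.smul_mem _ _ h5)
    rw [eq_smul_normalize h.ip_res6_pos, ← h.phi6_eq]
    exact Submodule.smul_mem _ _ h6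
  have h2 : xi 1 2 ∈ T := by
    rw [eq_smul_normalize ip_xi_one_two_pos]
    exact Submodule.smul_mem _ _ (hu 0)
  have h3 : xi 1 3 ∈ T := by
    rw [eq_smul_normalize ip_xi_one_three_pos]
    exact Submodule.smul_mem _ _ (hu 1)
  -- A unit translation shifts the index by four: two functions at each of the two half-integer
  -- nodes per unit. Only the indices `0, 1, 2, 3` have to be treated.
  have hn : xi 1 n = transl (n / 4) (xi 1 (n % 4)) := by
    rw [transl_xi_one]
    congr 1
    omega
  rw [hn]
  refine transl_mem_span_translates _ ?_
  have hlt := Int.emod_lt_of_pos n (by norm_num : (0 : ℤ) < 4)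
  have hge := Int.emod_nonneg n (by norm_num : (4 : ℤ) ≠ 0)
  interval_cases n % 4
  exacts [h0, h1, h2, h3]

/-- Refinement of Hermite splines. -/
theorem xi_one_mem_span_xi_two (n : ℤ) : xi 1 n ∈ Submodule.span ℝ (Set.range (xi 2)) := by
  have hm : ∀ (c : ℝ) (n : ℤ), c • xi 2 n ∈ Submodule.span ℝ (Set.range (xi 2)) := fun c n =>
    Submodule.smul_mem _ _ (Submodule.subset_span ⟨n, rfl⟩)
  have harg : ∀ (k : ℤ) (x : ℝ), 2 * (2 * x - k) + 1 = 4 * x - ((2 * k - 1 : ℤ) : ℝ) ∧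
      2 * (2 * x - k) = 4 * x - ((2 * k : ℤ) : ℝ) ∧
      2 * (2 * x - k) - 1 = 4 * x - ((2 * k + 1 : ℤ) : ℝ) := fun k x => by
    push_cast
    exact ⟨by ring, by ring, by ring⟩
  rcases Int.even_or_odd' n with ⟨k, rfl | rfl⟩
  · have : xi 1 (2 * k) = (Real.sqrt 2 / 4) • xi 2 (2 * (2 * k - 1)) +
        (Real.sqrt 2 * 3 / 8) • xi 2 (2 * (2 * k - 1) + 1) +
        (Real.sqrt 2 / 2) • xi 2 (2 * (2 * k)) +
        (Real.sqrt 2 / 4) • xi 2 (2 * (2 * k + 1)) +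
        (-Real.sqrt 2 * 3 / 8) • xi 2 (2 * (2 * k + 1) + 1) := by
      funext x
      obtain ⟨e1, e2, e3⟩ := harg k x
      simp only [Pi.add_apply, Pi.smul_apply, smul_eq_mul, xi_two_apply_even, xi_two_apply_odd,
        xi_one_apply_even]
      rw [hermite1_refine, e3, e1, e2]
      ring
    rw [this]
    exact add_mem (add_mem (add_mem (add_mem (hm _ _) (hm _ _)) (hm _ _)) (hm _ _)) (hm _ _)
  · have : xi 1 (2 * k + 1) = (-Real.sqrt 2 / 16) • xi 2 (2 * (2 * k - 1)) +
        (-Real.sqrt 2 / 16) • xi 2 (2 * (2 * k - 1) + 1) +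
        (Real.sqrt 2 / 4) • xi 2 (2 * (2 * k) + 1) +
        (Real.sqrt 2 / 16) • xi 2 (2 * (2 * k + 1)) +
        (-Real.sqrt 2 / 16) • xi 2 (2 * (2 * k + 1) + 1) := by
      funext x
      obtain ⟨e1, e2, e3⟩ := harg k x
      simp only [Pi.add_apply, Pi.smul_apply, smul_eq_mul, xi_two_apply_even, xi_two_apply_odd,
        xi_one_apply_odd]
      rw [hermite2_refine, e3, e1, e2]
      ring
    rw [this]
    exact add_mem (add_mem (add_mem (add_mem (hm _ _) (hm _ _)) (hm _ _)) (hm _ _)) (hm _ _)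

theorem IsAdmissible.translates_mem_span (h : IsAdmissible f3 f4) (p : Fin 6 × ℤ) :
    translates f3 f4 p ∈ Submodule.span ℝ (Set.range (xi 2)) := by
  set T := Submodule.span ℝ (Set.range (xi 2)) with hT
  have htr : ∀ {f : ℝ → ℝ} (k : ℤ), f ∈ T → transl k f ∈ T := fun k hf =>
    transl_mem_span (fun n => by
      rw [transl_xi_two]
      exact Submodule.subset_span ⟨_, rfl⟩) hf
  have hA1 : spaceA1 ≤ T := Submodule.span_mono (Set.image_subset_range _ _)
  have hu : ∀ i, innerGen f3 f4 i ∈ T := fun i => by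
    fin_cases i
    · exact Submodule.smul_mem _ _ (xi_one_mem_span_xi_two 2)
    · exact Submodule.smul_mem _ _ (xi_one_mem_span_xi_two 3)
    · exact hA1 h.mem_ominus_left.1
    · exact hA1 h.mem_ominus_right.1
  have hr : ∀ f ∈ T, residual (innerGen f3 f4) f ∈ T := fun f hf =>
    sub_mem (sub_mem hf (sum_mem fun i _ => Submodule.smul_mem _ _ (hu i)))
      (sum_mem fun i _ => Submodule.smul_mem _ _ (by
        rw [shift_eq_transl]
        exact htr _ (hu i)))
  have hspan : Submodule.span ℝ {res0 f3 f4, res1 f3 f4} ≤ T := by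
    refine Submodule.span_le.2 ?_
    rintro f (rfl | rfl)
    · exact hr _ (xi_one_mem_span_xi_two 0)
    · exact hr _ (xi_one_mem_span_xi_two 1)
  refine htr _ ?_
  rcases generators_cases f3 f4 p.1 with ⟨a, -, e⟩ | ⟨b, -, e⟩ <;> rw [e]
  · exact hu a
  · exact hspan (h.outerGen_mem_span b)

theorem IsAdmissible.hermiteSpace_le (h : IsAdmissible f3 f4) :
    hermiteSpace 1 ≤ scalingSpace (generators f3 f4) 0 := by
  refine closedSpan_le_closedSpan (fun n => ?_) fun n => ?_
  · obtain ⟨p, hp⟩ := scalingFun_zero (generators f3 f4) n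
    rw [hp]
    exact h.memLp_translates p
  · rw [range_scalingFun_zero]
    exact h.xi_one_mem_span n

theorem IsAdmissible.scalingSpace_le (h : IsAdmissible f3 f4) :
    scalingSpace (generators f3 f4) 0 ≤ hermiteSpace 2 := by
  refine closedSpan_le_closedSpan (memLp_xi 2) fun n => ?_
  obtain ⟨p, hp⟩ := scalingFun_zero (generators f3 f4) n
  rw [hp]
  exact h.translates_mem_span p

/-! ### The orthonormal basis -/

theorem IsAdmissible.exists_orthonormal_basis (h : IsAdmissible f3 f4) :
    ∃ e : Fin 6 × ℤ → L2R, (∀ p, ⇑(e p) =ᵐ[volume] translates f3 f4 p) ∧ Orthonormal ℝ e ∧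
      (Submodule.span ℝ (Set.range e)).topologicalClosure =
        scalingSpace (generators f3 f4) 0 := by
  have he : ∀ p, ⇑((h.memLp_translates p).toLp _) =ᵐ[volume] translates f3 f4 p := fun p =>
    (h.memLp_translates p).coeFn_toLp
  refine ⟨fun p => (h.memLp_translates p).toLp _, he, ?_, ?_⟩
  · rw [orthonormal_iff_ite]
    intro p q
    rw [inner_eq_ip, ip_congr_ae (he p) (he q)]
    exact h.ip_generators_translates p q
  · rw [scalingSpace, closedSpan]
    congr 2
    ext g
    constructor
    · rintro ⟨p, rfl⟩
      obtain ⟨n, hn⟩ := exists_scalingFun_zero_eq (generators f3 f4) p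
      exact ⟨n, (he p).trans (by rw [hn]; rfl)⟩
    · rintro ⟨n, hn⟩
      obtain ⟨p, hp⟩ := scalingFun_zero (generators f3 f4) n
      rw [hp] at hn
      exact ⟨p, Lp.ext ((he p).trans hn.symm)⟩

theorem isRieszBasis_of_orthonormal {ι : Type*} {e : ι → L2R} (he : Orthonormal ℝ e)
    {V : Submodule ℝ L2R} (hV : (Submodule.span ℝ (Set.range e)).topologicalClosure = V) :
    IsRieszBasis e V := by
  refine ⟨hV, 1, 1, one_pos, one_pos, fun b => ?_⟩
  have hs := he.orthogonalFamily.hasSum_linearIsometry b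
  simp only [LinearIsometry.toSpanSingleton_apply] at hs
  rw [hs.tsum_eq, LinearIsometry.norm_map, one_mul]
  exact ⟨hs.summable, le_rfl, le_rfl⟩

/-- At a point `x` only the translates by `⌊x⌋` and `⌊x⌋ + 1` can be nonzero, since all generators
vanish outside `(-1, 1)`. This explains the two copies of `C i ^ 2`. -/
theorem IsAdmissible.sum_sq_translates_le (h : IsAdmissible f3 f4) :
    ∃ K : ℝ, ∀ (x : ℝ) (s : Finset (Fin 6 × ℤ)), ∑ p ∈ s, translates f3 f4 p x ^ 2 ≤ K := by
  have hb : ∀ i, ∃ C, ∀ x, ‖generators f3 f4 i x‖ ≤ C := fun i =>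
    (hasCompactSupport_of_supportedIn (h.generators_mem i).2).exists_bound_of_continuous
      (h.generators_mem i).1.2.continuous
  choose C hC using hb
  refine ⟨∑ i, (C i ^ 2 + C i ^ 2), fun x s => ?_⟩
  have hnn : ∀ p, 0 ≤ translates f3 f4 p x ^ 2 := fun p => sq_nonneg _
  have hle : ∀ p, translates f3 f4 p x ^ 2 ≤ C p.1 ^ 2 := fun p => by
    rw [← sq_abs]
    exact pow_le_pow_left₀ (abs_nonneg _) (hC p.1 _) 2
  have hsub : s.filter (fun p => translates f3 f4 p x ^ 2 ≠ 0) ⊆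
      Finset.univ ×ˢ ({⌊x⌋, ⌊x⌋ + 1} : Finset ℤ) := by
    rintro ⟨i, k⟩ hp
    rw [Finset.mem_filter] at hp
    have hx : ¬(x ≤ -1 + (k : ℝ) ∨ 1 + (k : ℝ) ≤ x) := fun hx =>
      hp.2 (by rw [(h.translates_mem (i, k)).2 x hx]; norm_num)
    push Not at hx
    have l1 := Int.floor_le x
    have l2 := Int.lt_floor_add_one x
    have h1 : k < ⌊x⌋ + 2 := by exact_mod_cast (by linarith : (k : ℝ) < (⌊x⌋ : ℝ) + 2)
    have h2 : ⌊x⌋ < k + 1 := by exact_mod_cast (by linarith : (⌊x⌋ : ℝ) < (k : ℝ) + 1)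
    simp only [Finset.mem_product, Finset.mem_univ, true_and, Finset.mem_insert,
      Finset.mem_singleton]
    omega
  rw [← Finset.sum_filter_ne_zero]
  refine (Finset.sum_le_sum_of_subset_of_nonneg hsub fun p _ _ => hnn p).trans ?_
  rw [Finset.sum_product]
  refine Finset.sum_le_sum fun i _ => ?_
  rw [Finset.sum_pair (by omega)]
  exact add_le_add (hle _) (hle _)

/-- The Hermite space of level `j + 2` is interposed between the two spaces. -/
theorem IsAdmissible.scalingSpace_le_succ (h : IsAdmissible f3 f4) (j : ℤ) :
    scalingSpace (generators f3 f4) j ≤ scalingSpace (generators f3 f4) (j + 1) := by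
  have h1 := scalingSpace_add_le j h.scalingSpace_le
  have h2 := hermiteSpace_add_le (j + 1) h.hermiteSpace_le
  rw [zero_add] at h1 h2
  rw [show (1 : ℤ) + (j + 1) = 2 + j by ring] at h2
  exact h1.trans h2

theorem IsAdmissible.isOrthogonalMRA (h : IsAdmissible f3 f4) :
    IsOrthogonalMRA (scalingSpace (generators f3 f4)) (generators f3 f4) := by
  obtain ⟨e, he, horth, hspan⟩ := h.exists_orthonormal_basis
  have htr : IsTranslateFamily (generators f3 f4) e := fun i k => he (i, k)
  have hmono : Monotone (scalingSpace (generators f3 f4)) :=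
    monotone_int_of_le_succ h.scalingSpace_le_succ
  obtain ⟨K, hK⟩ := h.sum_sq_translates_le
  refine ⟨⟨fun j => isClosed_closedSpan _, h.scalingSpace_le_succ, mem_scalingSpace_iff _, ?_, ?_,
    e, htr, isRieszBasis_of_orthonormal horth hspan⟩, e, htr, horth, hspan⟩
  · refine dense_iUnion hmono fun j => ?_
    -- The Hermite space of level `j` already lies in `V_{j-1}`; monotonicity raises this to `V_j`.
    have := hermiteSpace_add_le ((j : ℤ) - 1) h.hermiteSpace_le
    rw [zero_add, add_sub_cancel] at this
    exact this.trans (hmono (by omega))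
  · refine iInf_scalingSpace_eq_bot (K := Real.sqrt K) fun f hf g hg => ?_
    rw [← hspan] at hf
    exact abs_inner_le_of_orthonormal horth he hK hf hg

theorem scalingFun_mem_c1Splines {φ : Fin 6 → ℝ → ℝ} (h : ∀ i, φ i ∈ c1Splines) (j n : ℤ) :
    scalingFun φ j n ∈ c1Splines := by
  have e : scalingFun φ j n = (2 : ℝ) ^ ((j : ℝ) / 2) • fun x =>
      φ (Fin.ofNat 6 ((n - 1) % 6).toNat) ((2 : ℝ) ^ j * x -
        ((((n - 1) / 6 : ℤ) : ℝ) + (if (n - 1) % 6 < 4 then 0 else 1))) := by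
    funext x
    simp only [scalingFun, Pi.smul_apply, smul_eq_mul, sub_sub]
  rw [e]
  exact Submodule.smul_mem _ _ (comp_affine_mem_c1Splines (h _) (by positivity) _)

end SplineMRA

end

theorem mainTheorem6 :
    (∃ f3 f4 : ℝ → ℝ, SplineMRA.IsAdmissible f3 f4) ∧
    ∀ f3 f4 : ℝ → ℝ, SplineMRA.IsAdmissible f3 f4 →
      (∀ i : Fin 6, SplineMRA.IsCubicSpline (SplineMRA.generators f3 f4 i) ∧
        ContDiff ℝ 1 (SplineMRA.generators f3 f4 i)) ∧
      (∀ j n : ℤ,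
        SplineMRA.IsCubicSpline (SplineMRA.scalingFun (SplineMRA.generators f3 f4) j n) ∧
        ContDiff ℝ 1 (SplineMRA.scalingFun (SplineMRA.generators f3 f4) j n)) ∧
      SplineMRA.IsOrthogonalMRA (SplineMRA.scalingSpace (SplineMRA.generators f3 f4))
        (SplineMRA.generators f3 f4) ∧
      (∃ q n : ℕ, 1 ≤ n ∧
        SplineMRA.hermiteSpace (q : ℤ) ≤ SplineMRA.scalingSpace (SplineMRA.generators f3 f4) 0 ∧
        SplineMRA.scalingSpace (SplineMRA.generators f3 f4) 0 ≤
          SplineMRA.hermiteSpace ((q : ℤ) + (n : ℤ))) := by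
  -- The inclusions hold with `q = n = 1`: `V₀` lies between the Hermite spaces with knots in `ℤ /
  -- 2` and in `ℤ / 4`.
  refine ⟨SplineMRA.exists_isAdmissible, fun f3 f4 h => ⟨fun i => (h.generators_mem i).1,
    SplineMRA.scalingFun_mem_c1Splines fun i => (h.generators_mem i).1, h.isOrthogonalMRA,
    1, 1, le_rfl, h.hermiteSpace_le, h.scalingSpace_le⟩⟩
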